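/- Let $\alpha>0$, let $dA$ be area measure on $\mathbb{C}$ and $d\lambda_\alpha(z)=\frac{\alpha}{\pi}e^{-\alpha|z|^2}dA(z)$. Let $F_h^2$ be the space of all harmonic functions $f:\mathbb{C}\to\mathbb{C}$ with $\int_{\mathbb{C}}|f|^2\,d\lambda_\alpha<\infty$, with the inner product $\langle f,g\rangle=\int_{\mathbb{C}} f\overline{g}\,d\lambda_\alpha$. Put $K_z(w)=e^{\alpha\bar z w}$, fix $c\in\{0,1\}$, and let $$H_z(w)=K_z(w)+\overline{K_z(w)}-c,\qquad h_z(w)=\frac{H_z(w)}{\sqrt{H_z(z)}}.$$ (For $c=1$, $H_z$ is the reproducing kernel of $F_h^2$; for $c=0$ it is the expression $K_z+\overline{K_z}$. The theorem holds for both choices.) For a positive Borel measure $\mu$ on $\mathbb{C}$ and $r>0$ let $$(T_\mu f)(z)=\int_{\mathbb{C}}f(w)\overline{H_z(w)}e^{-\alpha|w|^2}\,d\mu(w),\qquad \widetilde\mu(z)=\int_{\mathbb{C}}|h_z(u)|^2e^{-\alpha|u|^2}\,d\mu(u),\qquad \widehat\mu_r(z)=\frac{\mu(B(z,r))}{\pi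 r^2},$$ where $B(z,r)=\{w:|w-z|<r\}$. For $1\le p<\infty$, a bounded operator $T$ on $F_h^2$ belongs to the Schatten class $S_p$ if $Tx=\sum_i s_i\langle x,e_i\rangle f_i$ for some orthonormal families $(e_i)$, $(f_i)$ and some family of numbers $s_i\ge0$ in $\ell^p$; $S_\infty$ is the class of all bounded operators. Theorem. Let $\mu$ be a positive Borel measure on $\mathbb{C}$, $1\le p\le\infty$, $r>0$, and let $\{a_n\}_{n\ge 0}$ be an enumeration without repetition of the lattice $r\mathbb{Z}^2=\{mr+inr: m,n\in\mathbb{Z}\}$. The following are equivalent: (a) $T_\mu$ is in $S_p$, that is, the integral defining $(T_\mu f)(z)$ converges absolutely for all $f\in F_h^2$ and $z\in\mathbb{C}$, and $f\mapsto T_\mu f$ is a bounded operator on $F_h^2$ which belongs to $S_p$; (b) $\widetilde\mu\in L^p(\mathbb{C},dA)$; (c) $\widehat\mu_r\in L^p(\mathbb{C},dA)$; (d) all $\mu(B(a_n,r))$ are finite and the sequence $\{\mu(B(a_n,r))\}$ is in $\ell^p$. -/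

import Mathlib

open MeasureTheory Set InnerProductSpace
open scoped ENNReal ComplexConjugate

noncomputable section

namespace HFock

/-- The Gaussian measure `dλ_α(z) = (α/π) exp(-α|z|²) dA(z)` on `ℂ`. -/
def gaussian (α : ℝ) : Measure ℂ :=
  (volume : Measure ℂ).withDensity
    (fun z => ENNReal.ofReal (α / Real.pi * Real.exp (-α * ‖z‖ ^ 2)))

theorem volume_ac_gaussian {α : ℝ} (hα : 0 < α) : (volume : Measure ℂ) ≪ gaussian α := by
  refine withDensity_absolutelyContinuous' (Measurable.aemeasurable (by fun_prop)) ?_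
  refine Filter.Eventually.of_forall fun z => ?_
  simp only [ne_eq, ENNReal.ofReal_eq_zero, not_le]
  have := Real.pi_pos
  positivity

/-- The harmonic functions `f : ℂ → ℂ` with `∫ |f|² dλ_α < ∞`. -/
def space (α : ℝ) : Submodule ℂ (ℂ → ℂ) where
  carrier := {f | HarmonicOnNhd f univ ∧ MemLp f 2 (gaussian α)}
  add_mem' hf hg := ⟨hf.1.add hg.1, hf.2.add hg.2⟩
  zero_mem' := ⟨harmonicOnNhd_const 0, MemLp.zero⟩
  smul_mem' c f hf := by
    refine ⟨fun z hz => ?_, hf.2.const_smul c⟩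
    exact (hf.1 z hz).comp_CLM ((c • ContinuousLinearMap.id ℂ ℂ).restrictScalars ℝ)

/-- The harmonic Fock space `F_h²`: its elements are honest functions (not classes), and it carries
the inner product of `L²(λ_α)`. It is a separate type so that it does not inherit the topology of
pointwise convergence from `ℂ → ℂ`. -/
def HarmonicFock (α : ℝ) : Type := space α

instance (α : ℝ) : AddCommGroup (HarmonicFock α) := inferInstanceAs (AddCommGroup (space α))

instance (α : ℝ) : Module ℂ (HarmonicFock α) := inferInstanceAs (Module ℂ (space α))

instance (α : ℝ) : CoeFun (HarmonicFock α) (fun _ => ℂ → ℂ) := ⟨fun f => f.1⟩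

theorem HarmonicFock.harmonic {α : ℝ} (f : HarmonicFock α) : HarmonicOnNhd (f : ℂ → ℂ) univ :=
  f.2.1

theorem HarmonicFock.memLp {α : ℝ} (f : HarmonicFock α) : MemLp (f : ℂ → ℂ) 2 (gaussian α) :=
  f.2.2

theorem HarmonicFock.continuous {α : ℝ} (f : HarmonicFock α) : Continuous (f : ℂ → ℂ) :=
  continuousOn_univ.1 f.harmonic.continuousOn

theorem HarmonicFock.integrable_mul {α : ℝ} (f g : HarmonicFock α) :
    Integrable (fun w => g w * conj (f w)) (gaussian α) := by
  have h := f.memLp.star.integrable_mul g.memLp (p := 2) (q := 2)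
  refine h.congr (Filter.Eventually.of_forall fun w => ?_)
  simp [mul_comm]

/-- `inner f g = ∫ g conj(f) dλ_α`, the usual `⟨g, f⟩`: Mathlib's inner product is
conjugate-linear in its first argument. -/
@[reducible] def core (α : ℝ) [hα : Fact (0 < α)] : InnerProductSpace.Core ℂ (HarmonicFock α) where
  inner f g := ∫ w, g w * conj (f w) ∂(gaussian α)
  conj_inner_symm f g := by
    rw [← integral_conj]
    refine integral_congr_ae (Filter.Eventually.of_forall fun w => ?_)
    simp [mul_comm]
  re_inner_nonneg f := by
    have : ∫ w, f w * conj (f w) ∂(gaussian α) = ((∫ w, ‖f w‖ ^ 2 ∂(gaussian α) : ℝ) : ℂ) := by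
      rw [← integral_complex_ofReal]
      refine integral_congr_ae (Filter.Eventually.of_forall fun w => ?_)
      simp [Complex.mul_conj, Complex.normSq_eq_norm_sq]
    rw [this]
    simpa using integral_nonneg (fun w => by positivity)
  add_left f g h := by
    rw [← integral_add (f.integrable_mul h) (g.integrable_mul h)]
    refine integral_congr_ae (Filter.Eventually.of_forall fun w => ?_)
    change h w * conj (f w + g w) = _
    simp [mul_add]
  smul_left f g c := by
    rw [← integral_const_mul]
    refine integral_congr_ae (Filter.Eventually.of_forall fun w => ?_)
    change g w * conj (c * f w) = _
    simp only [map_mul]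
    ring
  definite f hf := by
    have h1 : ∫ w, f w * conj (f w) ∂(gaussian α) = ((∫ w, ‖f w‖ ^ 2 ∂(gaussian α) : ℝ) : ℂ) := by
      rw [← integral_complex_ofReal]
      refine integral_congr_ae (Filter.Eventually.of_forall fun w => ?_)
      simp [Complex.mul_conj, Complex.normSq_eq_norm_sq]
    have h2 : ∫ w, ‖f w‖ ^ 2 ∂(gaussian α) = 0 := by
      rw [h1] at hf
      exact_mod_cast hf
    have h3 : Integrable (fun w => ‖f w‖ ^ 2) (gaussian α) := by
      have := f.memLp.integrable_norm_pow (by norm_num)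
      simpa using this
    have h4 := (integral_eq_zero_iff_of_nonneg (fun w => by positivity) h3).1 h2
    have h5 : (f : ℂ → ℂ) =ᵐ[volume] (fun _ => 0) := by
      filter_upwards [(volume_ac_gaussian hα.out).ae_le h4] with w hw
      simpa using hw
    exact Subtype.ext (Continuous.ae_eq_iff_eq volume f.continuous continuous_const |>.1 h5)

instance (α : ℝ) [Fact (0 < α)] : NormedAddCommGroup (HarmonicFock α) :=
  (core α).toNormedAddCommGroup

instance (α : ℝ) [Fact (0 < α)] : InnerProductSpace ℂ (HarmonicFock α) :=
  InnerProductSpace.ofCore (core α).toCore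

/-- The Fock kernel `K_z(w) = exp(α conj(z) w)`. -/
def fockKernel (α : ℝ) (z w : ℂ) : ℂ := Complex.exp (α * conj z * w)

/-- `H_z(w) = K_z(w) + conj(K_z(w)) - c`. For `c = 1` this is the reproducing kernel of the
harmonic Fock space (the constants lie both in the analytic and in the anti-analytic part and must
be counted once); `c = 0` is the expression `K_z + conj(K_z)` without this correction. -/
def kernel (c α : ℝ) (z w : ℂ) : ℂ := fockKernel α z w + conj (fockKernel α z w) - c

/-- The normalized kernel `h_z(w) = H_z(w) / √(H_z(z))`; note that `H_z(z) = 2 exp(α|z|²) - c`. -/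
def normKernel (c α : ℝ) (z w : ℂ) : ℂ :=
  kernel c α z w / (Real.sqrt (kernel c α z z).re : ℂ)

/-- `T` is the Toeplitz operator `T_μ` on the harmonic Fock space: for all `f` and `z` the integral
`∫ f(w) conj(H_z(w)) exp(-α|w|²) dμ(w)` converges absolutely and equals `(T f)(z)`. -/
def IsToeplitz (c α : ℝ) [Fact (0 < α)] (μ : Measure ℂ)
    (T : HarmonicFock α →L[ℂ] HarmonicFock α) : Prop :=
  ∀ (f : HarmonicFock α) (z : ℂ),
    Integrable (fun w => f w * conj (kernel c α z w) * (Real.exp (-α * ‖w‖ ^ 2) : ℂ)) μ ∧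
    (T f) z = ∫ w, f w * conj (kernel c α z w) * (Real.exp (-α * ‖w‖ ^ 2) : ℂ) ∂μ

/-- Schatten class `S_p`. For `p < ∞`: operators with a canonical (singular value) decomposition
`T x = ∑ᵢ sᵢ ⟨x, eᵢ⟩ fᵢ`, where `(eᵢ)` and `(fᵢ)` are orthonormal, `sᵢ ≥ 0` and `(sᵢ) ∈ ℓ^p`
(such a `T` is automatically compact). `S_∞` consists of all bounded operators. -/
def IsSchatten {E : Type*} [NormedAddCommGroup E] [InnerProductSpace ℂ E] (p : ℝ≥0∞)
    (T : E →L[ℂ] E) : Prop :=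
  p = ∞ ∨ ∃ (ι : Type) (e f : ι → E) (s : ι → ℝ),
    Orthonormal ℂ e ∧ Orthonormal ℂ f ∧ (∀ i, 0 ≤ s i) ∧ Memℓp s p ∧
    ∀ x : E, HasSum (fun i => ((s i : ℂ) * inner ℂ (e i) x) • f i) (T x)

/-- The formula for `T_μ` defines a bounded operator on the harmonic Fock space, which belongs to
`S_p`. -/
def ToeplitzInSchatten (c α : ℝ) [Fact (0 < α)] (μ : Measure ℂ) (p : ℝ≥0∞) : Prop :=
  ∃ T : HarmonicFock α →L[ℂ] HarmonicFock α, IsToeplitz c α μ T ∧ IsSchatten p T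

/-- The Berezin transform `z ↦ ∫ |h_z(u)|² exp(-α|u|²) dμ(u)`, with values in `[0, ∞]`. -/
def berezin (c α : ℝ) (μ : Measure ℂ) (z : ℂ) : ℝ≥0∞ :=
  ∫⁻ u, ENNReal.ofReal (‖normKernel c α z u‖ ^ 2 * Real.exp (-α * ‖u‖ ^ 2)) ∂μ

/-- The averaging function `z ↦ μ(B(z,r)) / (π r²)`, with values in `[0, ∞]`. -/
def average (μ : Measure ℂ) (r : ℝ) (z : ℂ) : ℝ≥0∞ :=
  μ (Metric.ball z r) / ENNReal.ofReal (Real.pi * r ^ 2)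

/-- The square lattice `rℤ² = {m r + i n r : m, n ∈ ℤ}`. -/
def lattice (r : ℝ) : Set ℂ := {z | ∃ m n : ℤ, z = m * r + Complex.I * n * r}

end HFock

end

noncomputable section

namespace HFock

/-! ### Gaussian measure and the mean value property -/

/-! Write S for `constShift` (f ↦ f + (1 - c) f(0)) and R_z for the reproducing kernel `harmKernel`.
Since H_z = S R_z and S is self-adjoint with norm at most 2, both values of c are handled by the
same kernel.

Every f in the space is g + conj h with g, h entire and h(0) = 0, and the two parts are orthogonal.
Each part satisfies a local submean estimate under the weight e^{-α|w|²}, uniform in the centre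
(`exists_weightedSq_le`). Integrating against μ yields the Carleson-type bound ∫ |f|² e^{-α|w|²} dμ
≤ C ∫ splitSq f(w) μ(B(w,r)) dA(w).

From averages to operators: if J embeds the space into L²(e^{-α|w|²} dμ), then T_μ = S J* J, so |⟨f,
T_μ e⟩| ≤ ‖J S f‖² + ‖J e‖². For orthonormal systems, Jensen's and Bessel's inequalities bound the
sum of the p-th powers of these numbers (`exists_sum_rpow_le`). Such a bound forces compactness, and
applied to the singular vectors it puts the singular values in ℓ^p (`isSchatten_of_sum_le`).

From operators to the Berezin transform: up to normalization it is ⟨R_z, T_μ S R_z⟩. Inserting T_μ =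
∑ s_i ⟨·, e_i⟩ f_i bounds it by ∑ s_i w_i(z), where the weights w_i have a bounded sum over i at
each z and uniformly bounded integrals over z. Jensen's inequality then gives the L^p bound
(`lintegral_berezin_rpow_lt_top`).

From the Berezin transform to averages: H_z(u) contains an oscillating factor 2 cos θ - t and may
vanish for z near u, so there is no pointwise lower bound. Doubling z - u replaces θ by 2θ, and the
two factors cannot be small together; hence the mean over z in B(u,ρ) is bounded below
(`exists_one_le_lintegral_berezinKernel`).

Averages with different radii, and sums over the lattice, are compared by covering and packing
arguments and by convolution with finite measures. -/

/-- Measures on `ℂ` invariant under rotations about the origin. -/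
def RotInvariant (ν : Measure ℂ) : Prop :=
  ∀ ζ : Circle, MeasurePreserving (fun w : ℂ => (ζ : ℂ) * w) ν ν

theorem rotInvariant_volume : RotInvariant (volume : Measure ℂ) := fun ζ => by
  exact (rotation ζ).measurePreserving

theorem RotInvariant.withDensity {ν : Measure ℂ} (hν : RotInvariant ν) {φ : ℂ → ℝ≥0∞}
    (hφ : Measurable φ) (hrot : ∀ (ζ : Circle) w, φ (ζ * w) = φ w) :
    RotInvariant (ν.withDensity φ) := fun ζ => by
  refine ⟨by fun_prop, ?_⟩
  ext s hs
  rw [Measure.map_apply (by fun_prop) hs, withDensity_apply _ hs,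
    withDensity_apply _ ((measurable_const_mul (ζ : ℂ)) hs),
    ← (hν ζ).setLIntegral_comp_preimage hs hφ]
  simp [hrot]

theorem RotInvariant.restrict_ball {ν : Measure ℂ} (hν : RotInvariant ν) (R : ℝ) :
    RotInvariant (ν.restrict (Metric.ball 0 R)) := fun ζ => by
  have h := (hν ζ).restrict_preimage (Metric.isOpen_ball (x := (0 : ℂ)) (ε := R)).measurableSet
  have h2 : (fun w : ℂ => (ζ : ℂ) * w) ⁻¹' Metric.ball 0 R = Metric.ball 0 R := by
    ext w; simp [Circle.norm_coe]
  rwa [h2] at h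

theorem circleAverage_comp_mul {k : ℂ → ℂ} (hk : Differentiable ℂ k) (w : ℂ) :
    Real.circleAverage (fun ζ => k (ζ * w)) 0 1 = k 0 := by
  have h : Differentiable ℂ (fun ζ => k (ζ * w)) := by fun_prop
  rw [DiffContOnCl.circleAverage h.diffContOnCl]
  simp

/-- Rotating the variable does not change the integral; averaging over all rotations and using
Fubini puts the circle mean of k, which is k(0), inside. -/
theorem RotInvariant.integral_eq {ν : Measure ℂ} [SFinite ν] (hν : RotInvariant ν) {k : ℂ → ℂ}
    (hk : Differentiable ℂ k) (hi : Integrable k ν) :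
    ∫ w, k w ∂ν = ∫ _, k 0 ∂ν := by
  have hπ := Real.two_pi_pos
  have hc : Continuous k := hk.continuous
  have hint : Integrable (Function.uncurry fun (θ : ℝ) (w : ℂ) => k (Circle.exp θ * w))
      ((volume.restrict (Ioc 0 (2 * Real.pi))).prod ν) := by
    have hmeas : AEStronglyMeasurable
        (Function.uncurry fun (θ : ℝ) (w : ℂ) => k (Circle.exp θ * w))
        ((volume.restrict (Ioc 0 (2 * Real.pi))).prod ν) := by
      refine Continuous.aestronglyMeasurable ?_
      change Continuous fun p : ℝ × ℂ => k (Circle.exp p.1 * p.2)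
      fun_prop
    rw [integrable_prod_iff hmeas]
    constructor
    · refine Filter.Eventually.of_forall fun θ => ?_
      exact (hν (Circle.exp θ)).integrable_comp_of_integrable hi
    · have : (fun θ : ℝ => ∫ w, ‖Function.uncurry
          (fun (θ : ℝ) (w : ℂ) => k (Circle.exp θ * w)) (θ, w)‖ ∂ν) = fun _ => ∫ w, ‖k w‖ ∂ν := by
        ext θ
        have hme : MeasurableEmbedding (fun w : ℂ => (Circle.exp θ : ℂ) * w) :=
          (Homeomorph.mulLeft₀ _ (Circle.exp θ).coe_ne_zero).measurableEmbedding
        exact (hν (Circle.exp θ)).integral_comp hme (fun w => ‖k w‖)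
      rw [this]
      simp
  have h1 : ∀ θ : ℝ, ∫ w, k (Circle.exp θ * w) ∂ν = ∫ w, k w ∂ν := fun θ =>
    (hν (Circle.exp θ)).integral_comp
      (Homeomorph.mulLeft₀ _ (Circle.exp θ).coe_ne_zero).measurableEmbedding k
  have h2 : ∀ w : ℂ, (2 * Real.pi)⁻¹ • ∫ θ in Ioc 0 (2 * Real.pi), k (Circle.exp θ * w) = k 0 := by
    intro w
    rw [← circleAverage_comp_mul hk w, Real.circleAverage_def,
      intervalIntegral.integral_of_le hπ.le]
    simp [circleMap]
  calc ∫ w, k w ∂ν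
      = (2 * Real.pi)⁻¹ • ∫ θ in Ioc 0 (2 * Real.pi), ∫ w, k (Circle.exp θ * w) ∂ν := by
        simp only [h1]
        rw [setIntegral_const]
        simp [Real.pi_pos.le]
        field_simp
    _ = (2 * Real.pi)⁻¹ • ∫ w, (∫ θ : ℝ in Ioc 0 (2 * Real.pi), k (Circle.exp θ * w)) ∂ν := by
        rw [integral_integral_swap hint]
    _ = ∫ _, k 0 ∂ν := by
        rw [← integral_smul]
        simp only [h2]

/-- The weight `e^{-α|w|²}`. -/
def weight (α : ℝ) (w : ℂ) : ℝ := Real.exp (-α * ‖w‖ ^ 2)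

theorem weight_pos (α : ℝ) (w : ℂ) : 0 < weight α w := Real.exp_pos _

@[fun_prop]
theorem continuous_weight (α : ℝ) : Continuous (weight α) := by
  unfold weight; fun_prop

theorem gaussian_eq (α : ℝ) : gaussian α =
    (volume : Measure ℂ).withDensity (fun z => ENNReal.ofReal (α / Real.pi * weight α z)) := rfl

theorem rotInvariant_gaussian (α : ℝ) : RotInvariant (gaussian α) :=
  rotInvariant_volume.withDensity (by fun_prop) (by simp [Circle.norm_coe])

theorem lintegral_gaussian {α : ℝ} (hα : 0 < α) (F : ℂ → ℝ≥0∞) (hF : Measurable F) :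
    ∫⁻ w, F w ∂(gaussian α) =
      ENNReal.ofReal (α / Real.pi) * ∫⁻ w, F w * ENNReal.ofReal (weight α w) := by
  have := Real.pi_pos
  rw [gaussian_eq, lintegral_withDensity_eq_lintegral_mul _ (by fun_prop) hF,
    ← lintegral_const_mul _ (by fun_prop)]
  refine lintegral_congr fun w => ?_
  rw [Pi.mul_apply, ENNReal.ofReal_mul (by positivity)]
  ring

theorem integral_gaussian {α : ℝ} (hα : 0 < α) {E : Type*} [NormedAddCommGroup E]
    [NormedSpace ℝ E] (F : ℂ → E) :
    ∫ w, F w ∂(gaussian α) = ∫ w, (α / Real.pi * weight α w) • F w := by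
  have := Real.pi_pos
  rw [gaussian_eq, integral_withDensity_eq_integral_toReal_smul (by fun_prop) (by simp)]
  refine integral_congr_ae (Filter.Eventually.of_forall fun w => ?_)
  simp only
  rw [ENNReal.toReal_ofReal (by have := weight_pos α w; positivity)]

theorem integrable_gaussian_iff {α : ℝ} (hα : 0 < α) {E : Type*} [NormedAddCommGroup E]
    [NormedSpace ℝ E] (F : ℂ → E) :
    Integrable F (gaussian α) ↔ Integrable (fun w => weight α w • F w) := by
  have := Real.pi_pos
  rw [gaussian_eq, integrable_withDensity_iff_integrable_smul' (by fun_prop) (by simp)]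
  have h : (fun w => (ENNReal.ofReal (α / Real.pi * weight α w)).toReal • F w) =
      fun w => (α / Real.pi) • (weight α w • F w) := by
    ext w
    rw [ENNReal.toReal_ofReal (by have := weight_pos α w; positivity), mul_smul]
  rw [h, integrable_fun_smul_iff (by positivity)]

theorem integrable_weight {α : ℝ} (hα : 0 < α) : Integrable (weight α) := by
  have h := GaussianFourier.integrable_cexp_neg_mul_sq_norm_add (V := ℂ)
    (show 0 < (α : ℂ).re by simpa) 0 0
  refine h.norm.congr (Filter.Eventually.of_forall fun w => ?_)
  simp only [Complex.norm_exp, weight]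
  congr 1
  norm_cast
  simp

theorem integral_weight {α : ℝ} (hα : 0 < α) : ∫ w, weight α w = Real.pi / α := by
  have := GaussianFourier.integral_rexp_neg_mul_sq_norm (V := ℂ) hα
  simpa [weight] using this

theorem isProbabilityMeasure_gaussian {α : ℝ} (hα : 0 < α) : IsProbabilityMeasure (gaussian α) := by
  constructor
  have hπ := Real.pi_pos
  rw [gaussian_eq, withDensity_apply _ MeasurableSet.univ, Measure.restrict_univ,
    ← ofReal_integral_eq_lintegral_ofReal ((integrable_weight hα).const_mul _)
      (Filter.Eventually.of_forall fun w => by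
        have := weight_pos α w; simp only [Pi.zero_apply]; positivity),
    integral_const_mul, integral_weight hα]
  field_simp
  simp

/-! ### Entire functions and harmonic functions under the Gaussian weight -/

theorem enorm_sq_eq (x : ℂ) : ‖x‖ₑ ^ 2 = ENNReal.ofReal (‖x‖ ^ 2) := by
  rw [ENNReal.ofReal_pow (norm_nonneg _), ofReal_norm]

/-- If F, G are entire with Re F = Re f and Re G = Im f, then f = (F + iG)/2 + conj((F - iG)/2). The
constant of the second part is moved into the first so that h(0) = 0, which makes the parts
orthogonal. -/
theorem exists_entire_add_conj {f : ℂ → ℂ} (hf : HarmonicOnNhd f univ) :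
    ∃ g h : ℂ → ℂ, Differentiable ℂ g ∧ Differentiable ℂ h ∧ h 0 = 0 ∧
      ∀ z, f z = g z + conj (h z) := by
  obtain ⟨F, hF, hFre⟩ := HarmonicOnNhd.exists_analyticOnNhd_univ_re_eq
    (hf.comp_CLM Complex.reCLM)
  obtain ⟨G, hG, hGre⟩ := HarmonicOnNhd.exists_analyticOnNhd_univ_re_eq
    (hf.comp_CLM Complex.imCLM)
  have hF' : Differentiable ℂ F := fun z => (hF z trivial).differentiableAt
  have hG' : Differentiable ℂ G := fun z => (hG z trivial).differentiableAt
  refine ⟨fun z => (1 / 2 : ℝ) * (F z + Complex.I * G z) +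
      conj ((1 / 2 : ℝ) * (F 0 - Complex.I * G 0)),
    fun z => (1 / 2 : ℝ) * (F z - Complex.I * G z) - (1 / 2 : ℝ) * (F 0 - Complex.I * G 0),
    by fun_prop, by fun_prop, by simp, fun z => ?_⟩
  have h1 : (F z).re = (f z).re := congrFun hFre z
  have h2 : (G z).re = (f z).im := congrFun hGre z
  apply Complex.ext
  · simp [-Complex.ofReal_div, -one_div]
    linarith
  · simp [-Complex.ofReal_div, -one_div]
    linarith

theorem Continuous.integrable_restrict_ball {ν : Measure ℂ} [IsFiniteMeasureOnCompacts ν]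
    {E : Type*} [NormedAddCommGroup E] {f : ℂ → E} (hf : Continuous f) (z : ℂ) (R : ℝ) :
    Integrable f (ν.restrict (Metric.ball z R)) :=
  (hf.continuousOn.integrableOn_compact (isCompact_closedBall z R)).mono_set
    Metric.ball_subset_closedBall

theorem lintegral_enorm_sq_ball {ν : Measure ℂ} [IsFiniteMeasureOnCompacts ν] {f : ℂ → ℂ}
    (hf : Continuous f) (z : ℂ) (R : ℝ) :
    ∫⁻ w in Metric.ball z R, ‖f w‖ₑ ^ 2 ∂ν =
      ENNReal.ofReal (∫ w in Metric.ball z R, ‖f w‖ ^ 2 ∂ν) := by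
  rw [ofReal_integral_eq_lintegral_ofReal
    (Continuous.integrable_restrict_ball (by fun_prop) z R)
    (Filter.Eventually.of_forall fun w => by simp only [Pi.zero_apply]; positivity)]
  simp only [enorm_sq_eq]

/-- The cross term is 2 Re(gh), and gh is entire with value 0 at the origin, so it integrates to 0
over every centred ball. Exhausting by balls avoids any integrability assumption. -/
theorem lintegral_enorm_sq_add_conj {ν : Measure ℂ} [IsFiniteMeasureOnCompacts ν] [SFinite ν]
    (hν : RotInvariant ν) {g h : ℂ → ℂ} (hg : Differentiable ℂ g) (hh : Differentiable ℂ h)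
    (h0 : h 0 = 0) :
    ∫⁻ w, ‖g w + conj (h w)‖ₑ ^ 2 ∂ν = ∫⁻ w, ‖g w‖ₑ ^ 2 ∂ν + ∫⁻ w, ‖h w‖ₑ ^ 2 ∂ν := by
  have cg := hg.continuous
  have ch := hh.continuous
  have key : ∀ n : ℕ, ∫⁻ w in Metric.ball 0 (n : ℝ), ‖g w + conj (h w)‖ₑ ^ 2 ∂ν =
      ∫⁻ w in Metric.ball 0 (n : ℝ), ‖g w‖ₑ ^ 2 + ‖h w‖ₑ ^ 2 ∂ν := by
    intro n
    rw [lintegral_add_left (by fun_prop),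
      lintegral_enorm_sq_ball (by fun_prop : Continuous fun w => g w + conj (h w)),
      lintegral_enorm_sq_ball cg, lintegral_enorm_sq_ball ch,
      ← ENNReal.ofReal_add (integral_nonneg fun w => by positivity)
        (integral_nonneg fun w => by positivity)]
    have hgh : ∫ w in Metric.ball 0 (n : ℝ), g w * h w ∂ν = 0 := by
      rw [(hν.restrict_ball n).integral_eq (k := fun w => g w * h w) (hg.mul hh)
        (Continuous.integrable_restrict_ball (by fun_prop) 0 n)]
      simp [h0]
    have hre : ∫ w in Metric.ball 0 (n : ℝ), (g w * h w).re ∂ν = 0 := by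
      have := integral_re (μ := ν.restrict (Metric.ball 0 (n : ℝ))) (𝕜 := ℂ)
        (f := fun w => g w * h w) (Continuous.integrable_restrict_ball (by fun_prop) 0 n)
      simpa [hgh] using this
    have hpt : ∀ w, ‖g w + conj (h w)‖ ^ 2 = ‖g w‖ ^ 2 + ‖h w‖ ^ 2 + 2 * (g w * h w).re := by
      intro w
      simp only [← Complex.normSq_eq_norm_sq, Complex.normSq_add, Complex.normSq_conj,
        Complex.conj_conj]
    simp only [hpt]
    rw [integral_add (Continuous.integrable_restrict_ball (by fun_prop) 0 n)
      (Continuous.integrable_restrict_ball (by fun_prop) 0 n), integral_const_mul, hre,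
      integral_add (Continuous.integrable_restrict_ball (by fun_prop) 0 n)
      (Continuous.integrable_restrict_ball (by fun_prop) 0 n)]
    simp
  rw [← lintegral_add_left (by fun_prop)]
  have hcov : AECover ν Filter.atTop (fun n : ℕ => Metric.ball (0 : ℂ) (n : ℝ)) :=
    aecover_ball tendsto_natCast_atTop_atTop
  have t1 := hcov.lintegral_tendsto_of_countably_generated
    (f := fun w => ‖g w + conj (h w)‖ₑ ^ 2) (by fun_prop)
  have t2 := hcov.lintegral_tendsto_of_countably_generated
    (f := fun w => ‖g w‖ₑ ^ 2 + ‖h w‖ₑ ^ 2) (by fun_prop)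
  simp only [key] at t1
  exact tendsto_nhds_unique t1 t2

theorem ofReal_weight (α : ℝ) (w : ℂ) :
    (weight α w : ℂ) = Complex.exp (-α * (w * conj w)) := by
  rw [weight, Complex.ofReal_exp, Complex.mul_conj, Complex.normSq_eq_norm_sq]
  push_cast
  rfl

theorem weight_add_mul_conj_fockKernel (α : ℝ) (z v : ℂ) :
    (weight α (z + v) : ℂ) * conj (fockKernel α z (z + v)) =
      weight α v * Complex.exp (-α * conj z * v) := by
  rw [ofReal_weight, ofReal_weight, fockKernel, ← Complex.exp_conj, ← Complex.exp_add,
    ← Complex.exp_add]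
  congr 1
  simp only [map_mul, map_add, Complex.conj_conj, Complex.conj_ofReal]
  ring

theorem norm_exp_sq_mul_weight (α : ℝ) (z v : ℂ) :
    ‖Complex.exp (-α * conj z * v)‖ ^ 2 * weight α v =
      weight α (z + v) * Real.exp (α * ‖z‖ ^ 2) := by
  rw [Complex.norm_exp, weight, weight, ← Real.exp_nat_mul, ← Real.exp_add, ← Real.exp_add]
  congr 1
  simp only [← Complex.normSq_eq_norm_sq, Complex.normSq_apply, Complex.mul_re, Complex.neg_re,
    Complex.neg_im, Complex.ofReal_re, Complex.ofReal_im, Complex.conj_re, Complex.conj_im,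
    Complex.add_re, Complex.add_im, Complex.mul_im]
  push_cast
  ring

theorem differentiable_fockKernel (α : ℝ) (z : ℂ) : Differentiable ℂ (fockKernel α z) := by
  unfold fockKernel; fun_prop

/-- The reproducing property of the Fock kernel for entire functions. -/
theorem integral_mul_conj_fockKernel {α : ℝ} (hα : 0 < α) {G : ℂ → ℂ} (hG : Differentiable ℂ G)
    (z : ℂ) (hi : Integrable (fun w => G w * conj (fockKernel α z w)) (gaussian α)) :
    ∫ w, G w * conj (fockKernel α z w) ∂(gaussian α) = G z := by
  have := isProbabilityMeasure_gaussian hα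
  -- Translation by z turns the weighted integrand into an entire function of v against the centred
  -- Gaussian; its value at v = 0 is G(z).
  have hpt : ∀ v, weight α (z + v) • (G (z + v) * conj (fockKernel α z (z + v))) =
      weight α v • (G (z + v) * Complex.exp (-α * conj z * v)) := by
    intro v
    simp only [Complex.real_smul]
    rw [mul_left_comm, weight_add_mul_conj_fockKernel]
    ring
  have hi2 : Integrable (fun v => G (z + v) * Complex.exp (-α * conj z * v)) (gaussian α) := by
    rw [integrable_gaussian_iff hα] at hi ⊢
    have := hi.comp_add_left z
    simpa only [hpt] using this
  have h1 := (rotInvariant_gaussian α).integral_eq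
    (k := fun v => G (z + v) * Complex.exp (-α * conj z * v)) (by fun_prop) hi2
  simp only [integral_const] at h1
  rw [integral_gaussian hα] at h1 ⊢
  rw [← integral_add_left_eq_self _ z]
  simp only [mul_smul, hpt] at h1 ⊢
  rw [h1]
  simp

/-- `|G(w)|² e^{-α|w|²}` with values in `[0, ∞]`. -/
def weightedSq (α : ℝ) (G : ℂ → ℂ) (w : ℂ) : ℝ≥0∞ := ‖G w‖ₑ ^ 2 * ENNReal.ofReal (weight α w)

theorem measurable_weightedSq {α : ℝ} {G : ℂ → ℂ} (hG : Continuous G) :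
    Measurable (weightedSq α G) := by
  unfold weightedSq; fun_prop

theorem lintegral_weightedSq {α : ℝ} (hα : 0 < α) {G : ℂ → ℂ} (hG : Continuous G) :
    ∫⁻ w, ‖G w‖ₑ ^ 2 ∂(gaussian α) = ENNReal.ofReal (α / Real.pi) * ∫⁻ w, weightedSq α G w :=
  lintegral_gaussian hα _ (by fun_prop)

/-- The entire function k(v) = G(z + v) e^{-α conj(z) v} has k(0) = G(z), and |k(v)|² e^{-α|v|²}
equals |G(z + v)|² e^{-α|z + v|²} up to the factor e^{α|z|²}. The mean value property of k² on
B(0,r) thus gives a constant independent of z. -/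
theorem exists_weightedSq_le {α : ℝ} (hα : 0 < α) {r : ℝ} (hr : 0 < r) :
    ∃ C : ℝ≥0∞, C ≠ ∞ ∧ ∀ (G : ℂ → ℂ), Differentiable ℂ G → ∀ z : ℂ,
      weightedSq α G z ≤ C * ∫⁻ w in Metric.ball z r, weightedSq α G w := by
  have := isProbabilityMeasure_gaussian hα
  have hm0 : gaussian α (Metric.ball 0 r) ≠ 0 := fun h =>
    (Metric.measure_ball_pos volume (0 : ℂ) hr).ne' (volume_ac_gaussian hα h)
  refine ⟨(gaussian α (Metric.ball 0 r))⁻¹ * ENNReal.ofReal (α / Real.pi),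
    ENNReal.mul_ne_top (by simpa) (by simp), fun G hG z => ?_⟩
  have hGc := hG.continuous
  set k : ℂ → ℂ := fun v => G (z + v) * Complex.exp (-α * conj z * v) with hk
  have hkd : Differentiable ℂ k := by fun_prop
  have hkc := hkd.continuous
  have h1 : gaussian α (Metric.ball 0 r) * ‖G z‖ₑ ^ 2 ≤
      ∫⁻ v in Metric.ball 0 r, ‖k v‖ₑ ^ 2 ∂(gaussian α) := by
    have h := ((rotInvariant_gaussian α).restrict_ball r).integral_eq
      (k := fun v => k v ^ 2) (by fun_prop) (Continuous.integrable_restrict_ball (by fun_prop) 0 r)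
    have h2 := enorm_integral_le_lintegral_enorm (μ := (gaussian α).restrict (Metric.ball 0 r))
      (fun v => k v ^ 2)
    rw [h] at h2
    simp only [integral_const, enorm_smul, enorm_pow] at h2
    refine le_trans (le_of_eq ?_) h2
    congr 1
    · rw [Real.enorm_eq_ofReal measureReal_nonneg]
      simp [Measure.real]
    · simp [hk]
  have h3 : ∫⁻ v in Metric.ball 0 r, ‖k v‖ₑ ^ 2 ∂(gaussian α) =
      ENNReal.ofReal (α / Real.pi) * ENNReal.ofReal (Real.exp (α * ‖z‖ ^ 2)) *
        ∫⁻ w in Metric.ball z r, weightedSq α G w := by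
    rw [← lintegral_indicator measurableSet_ball,
      lintegral_gaussian hα _ (Measurable.indicator (by fun_prop) measurableSet_ball),
      ← lintegral_indicator measurableSet_ball,
      ← lintegral_add_left_eq_self (indicator (Metric.ball z r) _) z, mul_assoc,
      ← lintegral_const_mul (f := fun v => indicator (Metric.ball z r) (weightedSq α G) (z + v)) _
        (((measurable_weightedSq hGc).indicator measurableSet_ball).comp (measurable_const_add z))]
    congr 1
    refine lintegral_congr fun v => ?_
    by_cases hv : v ∈ Metric.ball 0 r
    · have hv2 : z + v ∈ Metric.ball z r := by simpa using hv
      rw [indicator_of_mem hv, indicator_of_mem hv2, weightedSq, hk]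
      simp only [enorm_mul, mul_pow]
      rw [mul_assoc, enorm_sq_eq (Complex.exp _), ← ENNReal.ofReal_mul (by positivity),
        norm_exp_sq_mul_weight, ENNReal.ofReal_mul (weight_pos _ _).le]
      ring
    · have hv2 : z + v ∉ Metric.ball z r := by simpa using hv
      rw [indicator_of_notMem hv, indicator_of_notMem hv2]
      simp
  rw [h3] at h1
  have h4 : ENNReal.ofReal (Real.exp (α * ‖z‖ ^ 2)) * ENNReal.ofReal (weight α z) = 1 := by
    rw [← ENNReal.ofReal_mul (Real.exp_pos _).le, weight, ← Real.exp_add]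
    simp
  have h5 := mul_le_mul_left h1 (ENNReal.ofReal (weight α z))
  calc weightedSq α G z = (gaussian α (Metric.ball 0 r))⁻¹ *
        (gaussian α (Metric.ball 0 r) * ‖G z‖ₑ ^ 2 * ENNReal.ofReal (weight α z)) := by
        rw [mul_assoc, ← mul_assoc _⁻¹, ENNReal.inv_mul_cancel hm0 (measure_ne_top _ _), one_mul,
          weightedSq]
    _ ≤ (gaussian α (Metric.ball 0 r))⁻¹ * (ENNReal.ofReal (α / Real.pi) *
        ENNReal.ofReal (Real.exp (α * ‖z‖ ^ 2)) *
        (∫⁻ w in Metric.ball z r, weightedSq α G w) * ENNReal.ofReal (weight α z)) := by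
        gcongr
    _ = (gaussian α (Metric.ball 0 r))⁻¹ * (ENNReal.ofReal (α / Real.pi) *
        (ENNReal.ofReal (Real.exp (α * ‖z‖ ^ 2)) * ENNReal.ofReal (weight α z)) *
        (∫⁻ w in Metric.ball z r, weightedSq α G w)) := by ring
    _ = _ := by rw [h4]; ring

/-! ### The harmonic Fock space -/

section Space

variable {α : ℝ} [Fact (0 < α)]

theorem alpha_pos : 0 < α := Fact.out

instance : IsProbabilityMeasure (gaussian α) := isProbabilityMeasure_gaussian alpha_pos

theorem inner_eq_integral (f g : HarmonicFock α) :
    inner ℂ f g = ∫ w, g w * conj (f w) ∂(gaussian α) := rfl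

theorem norm_sq_of_inner_self {f : HarmonicFock α} {x : ℝ} (h : inner ℂ f f = (x : ℂ)) :
    ‖f‖ ^ 2 = x := by
  rw [← inner_self_eq_norm_sq (𝕜 := ℂ) f, h]
  simp

theorem integrable_conj {ν : Measure ℂ} {f : ℂ → ℂ} (hf : Integrable f ν) :
    Integrable (fun w => conj (f w)) ν :=
  Complex.conjCLE.toContinuousLinearMap.integrable_comp hf

theorem ofReal_norm_sq_eq_lintegral (f : HarmonicFock α) :
    ENNReal.ofReal (‖f‖ ^ 2) = ∫⁻ w, ‖f w‖ₑ ^ 2 ∂(gaussian α) := by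
  have h1 : ‖f‖ ^ 2 = ∫ w, ‖f w‖ ^ 2 ∂(gaussian α) := by
    refine norm_sq_of_inner_self ?_
    rw [inner_eq_integral, ← integral_complex_ofReal]
    refine integral_congr_ae (Filter.Eventually.of_forall fun w => ?_)
    simp [Complex.mul_conj, Complex.normSq_eq_norm_sq]
  have h3 : Integrable (fun w => ‖f w‖ ^ 2) (gaussian α) := by
    have := f.memLp.integrable_norm_pow (by norm_num)
    simpa using this
  rw [h1, ofReal_integral_eq_lintegral_ofReal h3
    (Filter.Eventually.of_forall fun w => by simp only [Pi.zero_apply]; positivity)]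
  simp only [enorm_sq_eq]

theorem enorm_sq_eq_lintegral (f : HarmonicFock α) :
    ‖f‖ₑ ^ 2 = ∫⁻ w, ‖f w‖ₑ ^ 2 ∂(gaussian α) := by
  rw [← ofReal_norm_sq_eq_lintegral, ENNReal.ofReal_pow (norm_nonneg _), ofReal_norm]

theorem eLpNorm_two_sq {ν : Measure ℂ} (f : ℂ → ℂ) :
    eLpNorm f 2 ν ^ 2 = ∫⁻ w, ‖f w‖ₑ ^ 2 ∂ν := by
  have := eLpNorm_nnreal_pow_eq_lintegral (μ := ν) (f := f) (p := 2) (by norm_num)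
  simpa using this

theorem memLp_two_of_lintegral {ν : Measure ℂ} {f : ℂ → ℂ} (hf : Continuous f)
    (h : ∫⁻ w, ‖f w‖ₑ ^ 2 ∂ν ≠ ∞) : MemLp f 2 ν := by
  refine ⟨hf.aestronglyMeasurable, ?_⟩
  rw [← eLpNorm_two_sq] at h
  exact lt_top_iff_ne_top.2 fun h2 => h (by simp [h2])

theorem enorm_eq_eLpNorm (f : HarmonicFock α) : ‖f‖ₑ = eLpNorm (f : ℂ → ℂ) 2 (gaussian α) := by
  have h := enorm_sq_eq_lintegral f
  rw [← eLpNorm_two_sq] at h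
  exact (ENNReal.pow_right_strictMono (n := 2) two_ne_zero).injective h

omit [Fact (0 < α)] in
theorem norm_fockKernel_sq_mul_weight (z w : ℂ) :
    ‖fockKernel α z w‖ ^ 2 * weight α w = weight α (w - z) * Real.exp (α * ‖z‖ ^ 2) := by
  have := norm_exp_sq_mul_weight α (-z) w
  rw [norm_neg, neg_add_eq_sub] at this
  rw [← this, fockKernel]
  simp

theorem memLp_fockKernel (z : ℂ) : MemLp (fockKernel α z) 2 (gaussian α) := by
  have hc := (differentiable_fockKernel α z).continuous
  refine (memLp_two_iff_integrable_sq_norm hc.aestronglyMeasurable).2 ?_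
  rw [integrable_gaussian_iff alpha_pos]
  have h := ((integrable_weight (α := α) alpha_pos).comp_sub_right z).mul_const
    (Real.exp (α * ‖z‖ ^ 2))
  refine h.congr (Filter.Eventually.of_forall fun w => ?_)
  simp only [smul_eq_mul]
  rw [← norm_fockKernel_sq_mul_weight, mul_comm]

theorem harmonicOnNhd_add_conj {g h : ℂ → ℂ} (hg : Differentiable ℂ g) (hh : Differentiable ℂ h) :
    HarmonicOnNhd (fun z => g z + conj (h z)) univ := by
  intro z _
  have h1 : HarmonicAt g z := (hg.analyticAt z).harmonicAt
  have h2 : HarmonicAt (conj h) z := (hh.analyticAt z).harmonicAt_conj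
  exact h1.add h2

variable (α) in
/-- The Fock kernel as an element of the harmonic Fock space. -/
def holKernel (z : ℂ) : HarmonicFock α :=
  ⟨fockKernel α z, fun w _ => ((differentiable_fockKernel α z).analyticAt w).harmonicAt,
    memLp_fockKernel z⟩

variable (α) in
/-- The conjugate Fock kernel without its constant term. -/
def antiKernel (z : ℂ) : HarmonicFock α :=
  ⟨fun w => conj (fockKernel α z w) - 1,
    by
      have := harmonicOnNhd_add_conj (g := fun _ => -1) (by fun_prop)
        (differentiable_fockKernel α z)
      simpa [neg_add_eq_sub] using this,
    (memLp_fockKernel z).star.sub (memLp_const 1)⟩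

theorem holKernel_apply (z w : ℂ) : holKernel α z w = fockKernel α z w := rfl

theorem antiKernel_apply (z w : ℂ) : antiKernel α z w = conj (fockKernel α z w) - 1 := rfl

theorem integrable_mul_of_memLp {ν : Measure ℂ} {f g : ℂ → ℂ} (hf : MemLp f 2 ν)
    (hg : MemLp g 2 ν) : Integrable (fun w => f w * g w) ν :=
  MemLp.integrable_mul (p := 2) (q := 2) hf hg

theorem memLp_conj {ν : Measure ℂ} {f : ℂ → ℂ} (hf : MemLp f 2 ν) :
    MemLp (fun w => conj (f w)) 2 ν := hf.star

theorem norm_holKernel_sq (z : ℂ) : ‖holKernel α z‖ ^ 2 = Real.exp (α * ‖z‖ ^ 2) := by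
  have h : inner ℂ (holKernel α z) (holKernel α z) = fockKernel α z z :=
    integral_mul_conj_fockKernel alpha_pos (differentiable_fockKernel α z) z
      (integrable_mul_of_memLp (memLp_fockKernel z) (memLp_conj (memLp_fockKernel z)))
  have h2 : fockKernel α z z = (Real.exp (α * ‖z‖ ^ 2) : ℂ) := by
    rw [fockKernel, mul_assoc, mul_comm (conj z), Complex.mul_conj, Complex.normSq_eq_norm_sq]
    push_cast
    rfl
  exact norm_sq_of_inner_self (h.trans h2)

omit [Fact (0 < α)] in
theorem fockKernel_zero_right (z : ℂ) : fockKernel α z 0 = 1 := by simp [fockKernel]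

omit [Fact (0 < α)] in
theorem fockKernel_zero_left (w : ℂ) : fockKernel α 0 w = 1 := by simp [fockKernel]

theorem integral_entire {G : ℂ → ℂ} (hG : Differentiable ℂ G) (hi : Integrable G (gaussian α)) :
    ∫ w, G w ∂(gaussian α) = G 0 := by
  rw [(rotInvariant_gaussian α).integral_eq hG hi]
  simp

/-- Each kernel reproduces one part and annihilates the other: h K_z and g (K_z - 1) are entire and
vanish at 0, so their Gaussian integrals are 0. -/
theorem HarmonicFock.exists_entire (f : HarmonicFock α) :
    ∃ g h : ℂ → ℂ, Differentiable ℂ g ∧ Differentiable ℂ h ∧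
      (∀ z, f z = g z + conj (h z)) ∧ (∀ z, inner ℂ (holKernel α z) f = g z) ∧
      (∀ z, inner ℂ (antiKernel α z) f = conj (h z)) ∧
      ‖f‖ₑ ^ 2 = ∫⁻ w, ‖g w‖ₑ ^ 2 ∂(gaussian α) + ∫⁻ w, ‖h w‖ₑ ^ 2 ∂(gaussian α) := by
  obtain ⟨g, h, hg, hh, h0, hf⟩ := exists_entire_add_conj f.harmonic
  have hsum : ‖f‖ₑ ^ 2 =
      ∫⁻ w, ‖g w‖ₑ ^ 2 ∂(gaussian α) + ∫⁻ w, ‖h w‖ₑ ^ 2 ∂(gaussian α) := by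
    rw [enorm_sq_eq_lintegral, ← lintegral_enorm_sq_add_conj (rotInvariant_gaussian α) hg hh h0]
    simp only [hf]
  have hfin : ‖f‖ₑ ^ 2 ≠ ∞ := by simp
  rw [hsum, ENNReal.add_ne_top] at hfin
  have mg : MemLp g 2 (gaussian α) := memLp_two_of_lintegral hg.continuous hfin.1
  have mh : MemLp h 2 (gaussian α) := memLp_two_of_lintegral hh.continuous hfin.2
  have mK := memLp_fockKernel (α := α)
  have dK := differentiable_fockKernel α
  refine ⟨g, h, hg, hh, hf, fun z => ?_, fun z => ?_, hsum⟩
  · have e : ∀ w, f w * conj (holKernel α z w) =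
        g w * conj (fockKernel α z w) + conj (h w * fockKernel α z w) := fun w => by
      rw [hf, holKernel_apply, map_mul]; ring
    have i1 := integrable_mul_of_memLp mg (memLp_conj (mK z))
    have i2 := integrable_mul_of_memLp mh (mK z)
    rw [inner_eq_integral]
    simp only [e]
    rw [integral_add i1 (integrable_conj i2),
      integral_conj, integral_mul_conj_fockKernel alpha_pos hg z i1,
      integral_entire (G := fun w => h w * fockKernel α z w) (hh.mul (dK z)) i2]
    simp [h0]
  · have e : ∀ w, f w * conj (antiKernel α z w) =
        g w * (fockKernel α z w - 1) +
          conj (h w * conj (fockKernel α z w) - h w) := fun w => by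
      rw [hf, antiKernel_apply]
      simp only [map_sub, map_mul, Complex.conj_conj, map_one]
      ring
    have i1 : Integrable (fun w => g w * (fockKernel α z w - 1)) (gaussian α) :=
      integrable_mul_of_memLp mg ((mK z).sub (memLp_const 1))
    have i2 := integrable_mul_of_memLp mh (memLp_conj (mK z))
    have i3 := mh.integrable (by norm_num)
    have hi3 : Integrable (fun w => h w * conj (fockKernel α z w) - h w) (gaussian α) := i2.sub i3
    rw [inner_eq_integral]
    simp only [e]
    rw [integral_add i1 (integrable_conj hi3),
      integral_conj, integral_sub i2 i3, integral_mul_conj_fockKernel alpha_pos hh z i2,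
      integral_entire hh i3]
    rw [integral_entire (G := fun w => g w * (fockKernel α z w - 1))
      (hg.mul ((dK z).sub_const 1)) i1]
    simp [h0, fockKernel_zero_right]

/-- The reproducing property, split into its analytic and anti-analytic part. -/
theorem HarmonicFock.apply_eq (f : HarmonicFock α) (z : ℂ) :
    f z = inner ℂ (holKernel α z) f + inner ℂ (antiKernel α z) f := by
  obtain ⟨g, h, -, -, hf, h1, h2, -⟩ := f.exists_entire
  rw [h1, h2, hf]

theorem norm_antiKernel_sq_le (z : ℂ) : ‖antiKernel α z‖ ^ 2 ≤ Real.exp (α * ‖z‖ ^ 2) := by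
  have mK := memLp_fockKernel (α := α)
  have dK := differentiable_fockKernel α
  have e : ∀ w, antiKernel α z w * conj (antiKernel α z w) =
      (fockKernel α z w - 1) * conj (fockKernel α z w) - (fockKernel α z w - 1) := fun w => by
    rw [antiKernel_apply]
    simp only [map_sub, Complex.conj_conj, map_one]
    ring
  have m2 : MemLp (fun w => fockKernel α z w - 1) 2 (gaussian α) := (mK z).sub (memLp_const 1)
  have i1 := integrable_mul_of_memLp m2 (memLp_conj (mK z))
  have i2 := m2.integrable (by norm_num)
  have h : inner ℂ (antiKernel α z) (antiKernel α z) = fockKernel α z z - 1 := by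
    rw [inner_eq_integral]
    simp only [e]
    rw [integral_sub i1 i2, integral_mul_conj_fockKernel alpha_pos ((dK z).sub_const 1) z i1,
      integral_entire ((dK z).sub_const 1) i2]
    simp [fockKernel_zero_right]
  have h3 : inner ℂ (holKernel α z) (holKernel α z) = fockKernel α z z :=
    integral_mul_conj_fockKernel alpha_pos (dK z) z
      (integrable_mul_of_memLp (mK z) (memLp_conj (mK z)))
  rw [← h3] at h
  have h4 : ‖antiKernel α z‖ ^ 2 = ‖holKernel α z‖ ^ 2 - 1 := by
    rw [← inner_self_eq_norm_sq (𝕜 := ℂ), ← inner_self_eq_norm_sq (𝕜 := ℂ), h]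
    simp
  rw [h4, norm_holKernel_sq]
  linarith

theorem norm_inner_holKernel_le (f : HarmonicFock α) (z : ℂ) :
    ‖inner ℂ (holKernel α z) f‖ ≤ Real.exp (α * ‖z‖ ^ 2) * ‖f‖ := by
  refine (norm_inner_le_norm _ _).trans ?_
  gcongr
  have h1 := norm_holKernel_sq (α := α) z
  have h2 : 1 ≤ Real.exp (α * ‖z‖ ^ 2) :=
    Real.one_le_exp (by have := alpha_pos (α := α); positivity)
  nlinarith [norm_nonneg (holKernel α z)]

theorem norm_inner_antiKernel_le (f : HarmonicFock α) (z : ℂ) :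
    ‖inner ℂ (antiKernel α z) f‖ ≤ Real.exp (α * ‖z‖ ^ 2) * ‖f‖ := by
  refine (norm_inner_le_norm _ _).trans ?_
  gcongr
  have h1 := norm_antiKernel_sq_le (α := α) z
  have h2 : 1 ≤ Real.exp (α * ‖z‖ ^ 2) :=
    Real.one_le_exp (by have := alpha_pos (α := α); positivity)
  nlinarith [norm_nonneg (antiKernel α z)]

/-- Point evaluations are bounded by e^{α|z|²} times the norm, so a norm-Cauchy sequence has locally
uniformly convergent entire parts. -/
theorem exists_entire_limit {G : ℕ → ℂ → ℂ} (hG : ∀ n, Differentiable ℂ (G n)) {b : ℕ → ℝ}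
    (hb : Filter.Tendsto b Filter.atTop (nhds 0))
    (hc : ∀ n m N, N ≤ n → N ≤ m → ∀ z,
      ‖G n z - G m z‖ ≤ Real.exp (α * ‖z‖ ^ 2) * b N) :
    ∃ g, Differentiable ℂ g ∧ ∀ z, Filter.Tendsto (fun n => G n z) Filter.atTop (nhds (g z)) := by
  have hlim : ∀ z, ∃ y, Filter.Tendsto (fun n => G n z) Filter.atTop (nhds y) := fun z => by
    refine cauchySeq_tendsto_of_complete
      (cauchySeq_of_le_tendsto_0 (fun N => Real.exp (α * ‖z‖ ^ 2) * b N) ?_ ?_)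
    · intro n m N hn hm
      rw [dist_eq_norm]
      exact hc n m N hn hm z
    · simpa using hb.const_mul (Real.exp (α * ‖z‖ ^ 2))
  choose g hg using hlim
  have hle : ∀ n z, ‖g z - G n z‖ ≤ Real.exp (α * ‖z‖ ^ 2) * b n := fun n z => by
    have h : Filter.Tendsto (fun m => ‖G m z - G n z‖) Filter.atTop (nhds ‖g z - G n z‖) :=
      ((hg z).sub_const _).norm
    refine le_of_tendsto h ?_
    filter_upwards [Filter.eventually_ge_atTop n] with m hm
    exact hc m n n hm le_rfl z
  refine ⟨g, ?_, hg⟩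
  rw [← differentiableOn_univ]
  refine TendstoLocallyUniformlyOn.differentiableOn (F := G) (φ := Filter.atTop) ?_
    (Filter.Eventually.of_forall fun n => (hG n).differentiableOn) isOpen_univ
  rw [tendstoLocallyUniformlyOn_univ, tendstoLocallyUniformly_iff_forall_isCompact]
  intro K hK
  obtain ⟨R, hR⟩ := hK.isBounded.exists_norm_le
  rw [Metric.tendstoUniformlyOn_iff]
  intro ε hε
  have hb2 : Filter.Tendsto (fun n => Real.exp (α * R ^ 2) * b n) Filter.atTop (nhds 0) := by
    simpa using hb.const_mul (Real.exp (α * R ^ 2))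
  filter_upwards [hb2.eventually (gt_mem_nhds hε)] with n hn z hz
  rw [dist_eq_norm]
  have hbn : 0 ≤ b n := by
    have := (norm_nonneg _).trans (hle n 0)
    simpa using this
  refine ((hle n z).trans ?_).trans_lt hn
  have := alpha_pos (α := α)
  have := hR z hz
  gcongr

instance : CompleteSpace (HarmonicFock α) := by
  refine Metric.complete_of_cauchySeq_tendsto fun f hf => ?_
  obtain ⟨b, hb0, hbd, hb⟩ := cauchySeq_iff_le_tendsto_0.1 hf
  choose g h hg hh hgh h1 h2 _ using fun n => (f n).exists_entire
  obtain ⟨g', hg', hgt⟩ := exists_entire_limit (α := α) hg hb (fun n m N hn hm z => by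
    rw [← h1, ← h1, ← inner_sub_right]
    refine (norm_inner_holKernel_le _ z).trans ?_
    rw [← dist_eq_norm]
    gcongr
    exact hbd n m N hn hm)
  obtain ⟨h', hh', hht⟩ := exists_entire_limit (α := α) hh hb (fun n m N hn hm z => by
    rw [← RCLike.norm_conj, map_sub, ← h2, ← h2, ← inner_sub_right]
    refine (norm_inner_antiKernel_le _ z).trans ?_
    rw [← dist_eq_norm]
    gcongr
    exact hbd n m N hn hm)
  set F : ℂ → ℂ := fun z => g' z + conj (h' z) with hF
  have hFh : HarmonicOnNhd F univ := harmonicOnNhd_add_conj hg' hh'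
  have hFc : Continuous F := by
    have := hg'.continuous
    have := hh'.continuous
    fun_prop
  have hlim : ∀ z, Filter.Tendsto (fun n => f n z) Filter.atTop (nhds (F z)) := fun z => by
    simp only [hgh]
    exact (hgt z).add ((Complex.continuous_conj.tendsto _).comp (hht z))
  have hsub : ∀ m n, ((f m - f n : HarmonicFock α) : ℂ → ℂ) = fun z => f m z - f n z :=
    fun m n => rfl
  -- Fatou's lemma upgrades pointwise convergence to convergence in norm.
  have hfat : ∀ n, eLpNorm (fun z => F z - f n z) 2 (gaussian α) ≤ ENNReal.ofReal (b n) := by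
    intro n
    refine (Lp.eLpNorm_lim_le_liminf_eLpNorm (f := fun m z => f m z - f n z)
      (fun m => ((f m).continuous.sub (f n).continuous).aestronglyMeasurable) _
      (Filter.Eventually.of_forall fun z => (hlim z).sub_const _)).trans ?_
    refine Filter.liminf_le_of_frequently_le' (Filter.Eventually.frequently ?_)
    filter_upwards [Filter.eventually_ge_atTop n] with m hm
    rw [← hsub, ← enorm_eq_eLpNorm, ← ofReal_norm, ← dist_eq_norm]
    exact ENNReal.ofReal_le_ofReal (hbd m n n hm le_rfl)
  have hFm : MemLp F 2 (gaussian α) := by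
    have h3 : MemLp (fun z => F z - f 0 z) 2 (gaussian α) :=
      ⟨(hFc.sub (f 0).continuous).aestronglyMeasurable,
        (hfat 0).trans_lt ENNReal.ofReal_lt_top⟩
    have h4 := h3.add (f 0).memLp
    refine (memLp_congr_ae (Filter.Eventually.of_forall fun z => ?_)).1 h4
    simp
  obtain ⟨F', hF'⟩ : ∃ F' : HarmonicFock α, (F' : ℂ → ℂ) = F := ⟨⟨F, hFh, hFm⟩, rfl⟩
  refine ⟨F', ?_⟩
  have hsub' : ∀ n, ((F' - f n : HarmonicFock α) : ℂ → ℂ) = fun z => F z - f n z :=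
    fun n => hF' ▸ rfl
  rw [tendsto_iff_norm_sub_tendsto_zero]
  refine squeeze_zero (fun n => norm_nonneg _) (fun n => ?_) hb
  rw [← norm_sub_rev, ← ENNReal.ofReal_le_ofReal_iff (hb0 n), ofReal_norm, enorm_eq_eLpNorm, hsub']
  exact hfat n

end Space

/-! ### Translation estimates for `L^p` norms -/

/-- Jensen's inequality in unnormalized form, from Hölder's inequality for F · 1. -/
theorem lintegral_rpow_le {X : Type*} [MeasurableSpace X] (ν : Measure X) {F : X → ℝ≥0∞}
    (hF : AEMeasurable F ν) {q : ℝ} (hq : 1 ≤ q) :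
    (∫⁻ x, F x ∂ν) ^ q ≤ ν univ ^ (q - 1) * ∫⁻ x, F x ^ q ∂ν := by
  rcases hq.eq_or_lt with rfl | hq
  · simp
  have hc := Real.HolderConjugate.conjExponent hq
  have hq0 : 0 < q := by linarith
  have h := ENNReal.lintegral_mul_le_Lp_mul_Lq ν hc hF (aemeasurable_const (b := (1 : ℝ≥0∞)))
  simp only [Pi.mul_apply, mul_one, ENNReal.one_rpow, lintegral_const, one_mul] at h
  have h2 := ENNReal.rpow_le_rpow h hq0.le
  rw [ENNReal.mul_rpow_of_nonneg _ _ hq0.le, ← ENNReal.rpow_mul, ← ENNReal.rpow_mul,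
    one_div_mul_cancel hq0.ne', ENNReal.rpow_one, mul_comm] at h2
  convert h2 using 3
  rw [Real.conjExponent]
  field_simp

theorem ae_lt_top_of_eLpNorm {F : ℂ → ℝ≥0∞} (hF : Measurable F) {p : ℝ≥0∞} (hp : 1 ≤ p)
    (h : eLpNorm F p volume < ∞) : ∀ᵐ z, F z < ∞ := by
  have hp0 : p ≠ 0 := (zero_lt_one.trans_le hp).ne'
  by_cases hpt : p = ∞
  · subst hpt
    rw [eLpNorm_exponent_top] at h
    filter_upwards [ae_le_eLpNormEssSup (f := F) (μ := volume)] with z hz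
    exact hz.trans_lt h
  · rw [eLpNorm_lt_top_iff_lintegral_rpow_enorm_lt_top hp0 hpt] at h
    have hpos := ENNReal.toReal_pos hp0 hpt
    filter_upwards [ae_lt_top (by simp only [enorm_eq_self]; fun_prop) h.ne] with z hz
    rwa [ENNReal.rpow_lt_top_iff_of_pos hpos] at hz

/-- A set of full Lebesgue measure is dense. This is how local finiteness of μ is extracted from L^p
conditions. -/
theorem exists_mem_ball_lt_top {F : ℂ → ℝ≥0∞} (hF : Measurable F) {p : ℝ≥0∞} (hp : 1 ≤ p)
    (h : eLpNorm F p volume < ∞) {U : Set ℂ} (hU : IsOpen U) (hne : U.Nonempty) :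
    ∃ z ∈ U, F z < ∞ := by
  obtain ⟨z, hz1, hz2⟩ := (Measure.dense_of_ae (ae_lt_top_of_eLpNorm hF hp h)).inter_open_nonempty
    U hU hne
  exact ⟨z, hz1, hz2⟩

/-- Convolution with a finite measure preserves L^p: Jensen's inequality in w, then translation
invariance of area in z. For p = ∞ the order of the two almost-everywhere quantifiers is exchanged.
-/
theorem eLpNorm_lt_top_of_le_translates {F G : ℂ → ℝ≥0∞} (hF : Measurable F) {p : ℝ≥0∞}
    (hp : 1 ≤ p) (ν : Measure ℂ) [IsFiniteMeasure ν]
    (hG : ∀ z, G z ≤ ∫⁻ w, F (z + w) ∂ν) (h : eLpNorm F p volume < ∞) :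
    eLpNorm G p volume < ∞ := by
  have hp0 : p ≠ 0 := (zero_lt_one.trans_le hp).ne'
  by_cases hpt : p = ∞
  · subst hpt
    rw [eLpNorm_exponent_top] at h ⊢
    set M := eLpNormEssSup F volume with hM
    have hae : ∀ᵐ z, F z ≤ M := ae_le_eLpNormEssSup (f := F)
    have h2 : ∀ᵐ w ∂ν, ∀ᵐ z, F (z + w) ≤ M := Filter.Eventually.of_forall fun w =>
      (measurePreserving_add_right volume w).quasiMeasurePreserving.ae hae
    have hms : MeasurableSet {x : ℂ × ℂ | F (x.1 + x.2) ≤ M} :=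
      (hF.comp measurable_add) measurableSet_Iic
    have h3 : ∀ᵐ z, ∀ᵐ w ∂ν, F (z + w) ≤ M :=
      (Measure.ae_ae_comm (p := fun z w => F (z + w) ≤ M) hms).2 h2
    refine lt_of_le_of_lt (b := M * ν univ) ?_ (ENNReal.mul_lt_top h (measure_lt_top _ _))
    refine essSup_le_of_ae_le _ ?_
    filter_upwards [h3] with z hz
    calc G z ≤ ∫⁻ w, F (z + w) ∂ν := hG z
      _ ≤ ∫⁻ _, M ∂ν := lintegral_mono_ae hz
      _ = M * ν univ := lintegral_const _
  · rw [eLpNorm_lt_top_iff_lintegral_rpow_enorm_lt_top hp0 hpt] at h ⊢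
    simp only [enorm_eq_self] at h ⊢
    have hq : 1 ≤ p.toReal := by simpa using ENNReal.toReal_mono hpt hp
    set q := p.toReal
    have hFq : Measurable fun x : ℂ × ℂ => F (x.1 + x.2) ^ q :=
      (hF.comp measurable_add).pow_const q
    calc ∫⁻ z, G z ^ q ≤ ∫⁻ z, ν univ ^ (q - 1) * ∫⁻ w, F (z + w) ^ q ∂ν := by
          refine lintegral_mono fun z => ?_
          refine (ENNReal.rpow_le_rpow (hG z) (by linarith)).trans ?_
          exact lintegral_rpow_le ν (hF.comp (measurable_const_add z)).aemeasurable hq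
      _ = ν univ ^ (q - 1) * ∫⁻ w, (∫⁻ z, F (z + w) ^ q) ∂ν := by
          rw [lintegral_const_mul _ hFq.lintegral_prod_right', lintegral_lintegral_swap]
          exact hFq.aemeasurable
      _ = ν univ ^ (q - 1) * ((∫⁻ z, F z ^ q) * ν univ) := by
          congr 1
          rw [← lintegral_const]
          refine lintegral_congr fun w => ?_
          exact lintegral_add_right_eq_self (fun z => F z ^ q) w
      _ < ∞ := ENNReal.mul_lt_top
          (ENNReal.rpow_lt_top_of_nonneg (by linarith) (measure_ne_top _ _))
          (ENNReal.mul_lt_top h (measure_lt_top _ _))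

/-- Fatou's lemma along sequences. It gives measurability in z for an arbitrary μ, where Tonelli's
theorem would need σ-finiteness or similar. -/
theorem lowerSemicontinuous_lintegral {μ : Measure ℂ} {Φ : ℂ → ℂ → ℝ≥0∞}
    (hm : ∀ z, Measurable (Φ z)) (hl : ∀ u, LowerSemicontinuous fun z => Φ z u) :
    LowerSemicontinuous fun z => ∫⁻ u, Φ z u ∂μ := by
  rw [lowerSemicontinuous_iff_isClosed_preimage]
  intro a
  refine IsSeqClosed.isClosed fun x z hx hz => ?_
  simp only [mem_preimage, mem_Iic] at hx ⊢
  calc ∫⁻ u, Φ z u ∂μ ≤ ∫⁻ u, Filter.liminf (fun n => Φ (x n) u) Filter.atTop ∂μ := by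
        refine lintegral_mono fun u => ?_
        refine ((hl u).le_liminf z).trans ?_
        exact Filter.liminf_le_liminf_of_le hz
      _ ≤ Filter.liminf (fun n => ∫⁻ u, Φ (x n) u ∂μ) Filter.atTop :=
        lintegral_liminf_le fun n => hm _
      _ ≤ a := Filter.liminf_le_of_frequently_le'
        (Filter.Eventually.of_forall hx).frequently

theorem measurable_measure_ball (μ : Measure ℂ) (r : ℝ) :
    Measurable fun z => μ (Metric.ball z r) := by
  have h : LowerSemicontinuous fun z => ∫⁻ u, (Metric.ball z r).indicator 1 u ∂μ := by
    refine lowerSemicontinuous_lintegral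
      (fun z => measurable_one.indicator measurableSet_ball) fun u => ?_
    have : (fun z => (Metric.ball z r).indicator (1 : ℂ → ℝ≥0∞) u) =
        (Metric.ball u r).indicator fun _ => 1 := by
      ext z
      simp only [indicator, Metric.mem_ball, dist_comm u z, Pi.one_apply]
    rw [this]
    exact Metric.isOpen_ball.lowerSemicontinuous_indicator zero_le_one
  simpa [lintegral_indicator_one measurableSet_ball] using h.measurable

/-- Both sides measure the pairs (u, w) with |u - z - w| < s. -/
theorem lintegral_measure_ball (μ ν : Measure ℂ) [SFinite μ] [SFinite ν] (s : ℝ) (z : ℂ) :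
    ∫⁻ u, ν (Metric.ball (u - z) s) ∂μ = ∫⁻ w, μ (Metric.ball (z + w) s) ∂ν := by
  have hms : MeasurableSet {x : ℂ × ℂ | dist x.2 (x.1 - z) < s} :=
    (isOpen_lt (by fun_prop) continuous_const).measurableSet
  have h1 : ∀ u, ν (Metric.ball (u - z) s) =
      ∫⁻ w, {x : ℂ × ℂ | dist x.2 (x.1 - z) < s}.indicator 1 (u, w) ∂ν := fun u => by
    rw [← lintegral_indicator_one measurableSet_ball]
    rfl
  have h2 : ∀ w, μ (Metric.ball (z + w) s) =
      ∫⁻ u, {x : ℂ × ℂ | dist x.2 (x.1 - z) < s}.indicator 1 (u, w) ∂μ := fun w => by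
    rw [← lintegral_indicator_one measurableSet_ball]
    refine lintegral_congr fun u => ?_
    have : dist w (u - z) = dist u (z + w) := by
      rw [dist_eq_norm, dist_eq_norm, ← norm_neg]; congr 1; ring
    simp only [indicator, Metric.mem_ball, mem_ofPred_eq, this, Pi.one_apply]
  simp only [h1, h2]
  exact lintegral_lintegral_swap (measurable_one.indicator hms).aemeasurable

theorem eLpNorm_lintegral_lt_top {μ : Measure ℂ} [IsLocallyFiniteMeasure μ] (ν : Measure ℂ)
    [IsFiniteMeasure ν] {p : ℝ≥0∞} (hp : 1 ≤ p) {s : ℝ} {Φ : ℂ → ℂ → ℝ≥0∞}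
    (hΦ : ∀ z u, Φ z u ≤ ν (Metric.ball (u - z) s))
    (h : eLpNorm (fun z => μ (Metric.ball z s)) p volume < ∞) :
    eLpNorm (fun z => ∫⁻ u, Φ z u ∂μ) p volume < ∞ := by
  refine eLpNorm_lt_top_of_le_translates (measurable_measure_ball μ s) hp ν (fun z => ?_) h
  rw [← lintegral_measure_ball]
  exact lintegral_mono fun u => hΦ z u

theorem volume_ball_ne_zero {r : ℝ} (hr : 0 < r) (z : ℂ) : volume (Metric.ball z r) ≠ 0 :=
  (Metric.measure_ball_pos volume z hr).ne'

/-- For u in B(z,r) the ball B(u - z, s) lies in B(0, r + s), so the indicator of B(z,r) is at most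
the normalized area of B(u - z, s) inside B(0, r + s). No relation between r and s is needed. -/
theorem eLpNorm_measure_ball_change {μ : Measure ℂ} [IsLocallyFiniteMeasure μ] {p : ℝ≥0∞}
    (hp : 1 ≤ p) {r s : ℝ} (hs : 0 < s)
    (h : eLpNorm (fun z => μ (Metric.ball z s)) p volume < ∞) :
    eLpNorm (fun z => μ (Metric.ball z r)) p volume < ∞ := by
  have hc : (volume (Metric.ball (0 : ℂ) s))⁻¹ ≠ ∞ := by simpa using volume_ball_ne_zero hs 0
  have := isFiniteMeasure_restrict.2
    (measure_ball_lt_top (μ := (volume : Measure ℂ)) (x := 0) (r := r + s)).ne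
  have : IsFiniteMeasure ((volume (Metric.ball (0 : ℂ) s))⁻¹ •
      (volume : Measure ℂ).restrict (Metric.ball 0 (r + s))) :=
    Measure.smul_finite _ hc
  have h2 := eLpNorm_lintegral_lt_top (Φ := fun z u => (Metric.ball z r).indicator 1 u)
    ((volume (Metric.ball (0 : ℂ) s))⁻¹ • (volume : Measure ℂ).restrict (Metric.ball 0 (r + s)))
    hp (fun z u => ?_) h
  · simpa only [lintegral_indicator_one measurableSet_ball] using h2
  · by_cases hu : u ∈ Metric.ball z r
    · have hsub : Metric.ball (u - z) s ⊆ Metric.ball 0 (r + s) := by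
        refine Metric.ball_subset_ball' ?_
        rw [Metric.mem_ball, dist_eq_norm] at hu
        rw [dist_zero_right]
        linarith
      rw [indicator_of_mem hu, Measure.smul_apply, Measure.restrict_apply measurableSet_ball,
        inter_eq_left.2 hsub, Measure.addHaar_ball_center _ (u - z), smul_eq_mul,
        ENNReal.inv_mul_cancel (volume_ball_ne_zero hs 0) measure_ball_lt_top.ne]
      simp
    · rw [indicator_of_notMem hu]
      simp

theorem eLpNorm_average_lt_top_iff {μ : Measure ℂ} {p : ℝ≥0∞} (hp : 1 ≤ p) {r : ℝ} (hr : 0 < r) :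
    eLpNorm (average μ r) p volume < ∞ ↔
      eLpNorm (fun z => μ (Metric.ball z r)) p volume < ∞ := by
  have hc0 : ENNReal.ofReal (Real.pi * r ^ 2) ≠ 0 := by
    have := Real.pi_pos
    simp only [ne_eq, ENNReal.ofReal_eq_zero, not_le]; positivity
  have hm := measurable_measure_ball μ r
  constructor
  · intro h
    -- Multiplication by a constant is convolution with a multiple of the point mass at 0.
    have : IsFiniteMeasure (ENNReal.ofReal (Real.pi * r ^ 2) • Measure.dirac (0 : ℂ)) :=
      Measure.smul_finite _ ENNReal.ofReal_ne_top
    refine eLpNorm_lt_top_of_le_translates (F := average μ r) (hm.div_const _) hp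
      (ENNReal.ofReal (Real.pi * r ^ 2) • Measure.dirac 0) (fun z => ?_) h
    rw [lintegral_smul_measure, lintegral_dirac, add_zero, smul_eq_mul]
    rw [HFock.average, ENNReal.mul_div_cancel hc0 ENNReal.ofReal_ne_top]
  · intro h
    have : IsFiniteMeasure ((ENNReal.ofReal (Real.pi * r ^ 2))⁻¹ • Measure.dirac (0 : ℂ)) :=
      Measure.smul_finite _ (by simpa using hc0)
    refine eLpNorm_lt_top_of_le_translates hm hp
      ((ENNReal.ofReal (Real.pi * r ^ 2))⁻¹ • Measure.dirac 0) (fun z => ?_) h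
    rw [lintegral_smul_measure, lintegral_dirac, add_zero, smul_eq_mul, HFock.average, div_eq_mul_inv,
      mul_comm]

theorem isLocallyFiniteMeasure_of_average {μ : Measure ℂ} {p : ℝ≥0∞} (hp : 1 ≤ p) {r : ℝ}
    (hr : 0 < r) (h : eLpNorm (fun z => μ (Metric.ball z r)) p volume < ∞) :
    IsLocallyFiniteMeasure μ := by
  refine ⟨fun z => ?_⟩
  obtain ⟨w, hw, hlt⟩ := exists_mem_ball_lt_top (measurable_measure_ball μ r) hp h
    (Metric.isOpen_ball (x := z) (ε := r)) ⟨z, Metric.mem_ball_self hr⟩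
  exact ⟨Metric.ball w r, Metric.isOpen_ball.mem_nhds (by rwa [Metric.mem_ball_comm]), hlt⟩

/-- If |w - z| < r then μ(B(z,r)) ≤ μ(B(w,2r)); taking the L^p norm over w in B(z,r) bounds the left
side uniformly in z. -/
theorem exists_measure_ball_le {μ : Measure ℂ} [IsLocallyFiniteMeasure μ] {p : ℝ≥0∞}
    (hp : 1 ≤ p) {r : ℝ} (hr : 0 < r)
    (h : eLpNorm (fun z => μ (Metric.ball z r)) p volume < ∞) :
    ∃ M : ℝ≥0∞, M ≠ ∞ ∧ ∀ z, μ (Metric.ball z r) ≤ M := by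
  have hp0 : p ≠ 0 := (zero_lt_one.trans_le hp).ne'
  have h2 := eLpNorm_measure_ball_change (r := 2 * r) hp hr h
  set N := eLpNorm (fun z => μ (Metric.ball z (2 * r))) p volume
  -- For p = ∞ the exponent is 1/0 = 0, so v = 1 and one computation covers all p.
  set v := volume (Metric.ball (0 : ℂ) r) ^ (1 / p.toReal) with hv
  have hv0 : v ≠ 0 := by
    rw [hv, ne_eq, ENNReal.rpow_eq_zero_iff, not_or]
    exact ⟨fun h => volume_ball_ne_zero hr 0 h.1, fun h => measure_ball_lt_top.ne h.1⟩
  have hvt : v ≠ ∞ := ENNReal.rpow_ne_top_of_nonneg (by positivity) measure_ball_lt_top.ne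
  refine ⟨N / v, ENNReal.div_ne_top h2.ne hv0, fun z => ?_⟩
  rw [ENNReal.le_div_iff_mul_le (Or.inl hv0) (Or.inl hvt)]
  calc μ (Metric.ball z r) * v =
      eLpNorm (fun _ : ℂ => μ (Metric.ball z r)) p (volume.restrict (Metric.ball z r)) := by
        rw [eLpNorm_const _ hp0 (by simpa using volume_ball_ne_zero hr z),
          Measure.restrict_apply_univ, Measure.addHaar_ball_center (volume : Measure ℂ) z, enorm_eq_self]
    _ ≤ eLpNorm (fun w => μ (Metric.ball w (2 * r))) p (volume.restrict (Metric.ball z r)) := by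
        refine eLpNorm_mono_enorm_ae ?_
        filter_upwards [ae_restrict_mem measurableSet_ball] with w hw
        simp only [enorm_eq_self]
        refine measure_mono (Metric.ball_subset_ball' ?_)
        rw [Metric.mem_ball, dist_comm] at hw
        linarith
    _ ≤ N := eLpNorm_mono_measure _ Measure.restrict_le_self

/-! ### Averages over a lattice -/

/-- Rounding both coordinates gives distance at most r/√2. The bound 3r/4 leaves r/4 to spare, so
that B(z, r/4) lies in B(w, r). -/
theorem exists_dist_lattice_lt {r : ℝ} (hr : 0 < r) (z : ℂ) :
    ∃ w ∈ lattice r, dist z w < 3 * r / 4 := by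
  have key : ∀ x : ℝ, |x - round (x / r) * r| ≤ r / 2 := fun x => by
    have h := abs_sub_round (x / r)
    have h2 : x - round (x / r) * r = (x / r - round (x / r)) * r := by field_simp
    rw [h2, abs_mul, abs_of_pos hr]
    nlinarith
  refine ⟨_, ⟨round (z.re / r), round (z.im / r), rfl⟩, ?_⟩
  rw [dist_eq_norm]
  refine lt_of_pow_lt_pow_left₀ 2 (by positivity) ?_
  rw [← Complex.normSq_eq_norm_sq, Complex.normSq_apply]
  have h1 := abs_le.1 (key z.re)
  have h2 := abs_le.1 (key z.im)
  simp only [Complex.sub_re, Complex.add_re, Complex.mul_re, Complex.intCast_re, Complex.ofReal_re,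
    Complex.intCast_im, Complex.ofReal_im, Complex.I_re, Complex.I_im, Complex.sub_im,
    Complex.add_im, Complex.mul_im]
  have h3 : (z.re - round (z.re / r) * r) ^ 2 ≤ (r / 2) ^ 2 := sq_le_sq' (by linarith) h1.2
  have h4 : (z.im - round (z.im / r) * r) ^ 2 ≤ (r / 2) ^ 2 := sq_le_sq' (by linarith) h2.2
  nlinarith [sq_pos_of_pos hr]

theorem le_dist_of_mem_lattice {r : ℝ} (hr : 0 < r) {z w : ℂ} (hz : z ∈ lattice r)
    (hw : w ∈ lattice r) (hne : z ≠ w) : r ≤ dist z w := by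
  obtain ⟨m, n, rfl⟩ := hz
  obtain ⟨k, l, rfl⟩ := hw
  have hre : ((m * r + Complex.I * n * r : ℂ) - (k * r + Complex.I * l * r)).re = (m - k : ℤ) * r := by
    simp; ring
  have him : ((m * r + Complex.I * n * r : ℂ) - (k * r + Complex.I * l * r)).im = (n - l : ℤ) * r := by
    simp; ring
  have key : ∀ j : ℤ, j ≠ 0 → r ≤ |(j : ℝ) * r| := fun j hj => by
    rw [abs_mul, abs_of_pos hr]
    have : (1 : ℝ) ≤ |(j : ℝ)| := by exact_mod_cast Int.one_le_abs hj
    nlinarith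
  rw [dist_eq_norm]
  by_cases h1 : m - k = 0
  · have h2 : n - l ≠ 0 := fun h2 => hne (by rw [sub_eq_zero.1 h1, sub_eq_zero.1 h2])
    exact (key _ h2).trans (him ▸ Complex.abs_im_le_norm _)
  · exact (key _ h1).trans (hre ▸ Complex.abs_re_le_norm _)

theorem memℓp_toReal_iff {x : ℕ → ℝ≥0∞} (hx : ∀ n, x n < ∞) {p : ℝ≥0∞} (hp0 : p ≠ 0)
    (hpt : p ≠ ∞) : Memℓp (fun n => (x n).toReal) p ↔ ∑' n, x n ^ p.toReal ≠ ∞ := by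
  have hpos := ENNReal.toReal_pos hp0 hpt
  rw [memℓp_gen_iff hpos]
  have h : ∀ n, ‖(x n).toReal‖ ^ p.toReal = (x n ^ p.toReal).toReal := fun n => by
    rw [Real.norm_of_nonneg ENNReal.toReal_nonneg, ENNReal.toReal_rpow]
  simp only [h]
  refine ⟨fun hs => ?_, ENNReal.summable_toReal⟩
  have h2 := hs.tsum_ofReal_ne_top
  convert h2 using 4 with n
  rw [ENNReal.ofReal_toReal (ENNReal.rpow_ne_top_of_nonneg hpos.le (hx n).ne)]

section Lattice

variable {μ : Measure ℂ} {p : ℝ≥0∞} {r : ℝ} {a : ℕ → ℂ}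

theorem isLocallyFiniteMeasure_of_lattice (hr : 0 < r) (ha : Set.range a = lattice r)
    (h : ∀ n, μ (Metric.ball (a n) r) < ∞) : IsLocallyFiniteMeasure μ := by
  refine ⟨fun z => ?_⟩
  obtain ⟨w, hw, hd⟩ := exists_dist_lattice_lt hr z
  obtain ⟨n, rfl⟩ := ha ▸ hw
  exact ⟨_, Metric.isOpen_ball.mem_nhds (by rw [Metric.mem_ball]; linarith), h n⟩

theorem eLpNorm_measure_ball_of_lattice (hp : 1 ≤ p) (hr : 0 < r)
    (ha : Set.range a = lattice r) (h : ∀ n, μ (Metric.ball (a n) r) < ∞)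
    (hl : Memℓp (fun n => (μ (Metric.ball (a n) r)).toReal) p) :
    eLpNorm (fun z => μ (Metric.ball z (r / 4))) p volume < ∞ := by
  have hp0 : p ≠ 0 := (zero_lt_one.trans_le hp).ne'
  have hcov : ∀ z, ∃ n, dist z (a n) < 3 * r / 4 := fun z => by
    obtain ⟨w, hw, hd⟩ := exists_dist_lattice_lt hr z
    obtain ⟨n, rfl⟩ := ha ▸ hw
    exact ⟨n, hd⟩
  have hle : ∀ z n, dist z (a n) < 3 * r / 4 →
      μ (Metric.ball z (r / 4)) ≤ μ (Metric.ball (a n) r) := fun z n hd =>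
    measure_mono (Metric.ball_subset_ball' (by linarith))
  by_cases hpt : p = ∞
  · subst hpt
    obtain ⟨M, hM⟩ := memℓp_infty_iff.1 hl
    rw [eLpNorm_exponent_top]
    refine lt_of_le_of_lt (essSup_le_of_ae_le (ENNReal.ofReal M)
      (Filter.Eventually.of_forall fun z => ?_)) ENNReal.ofReal_lt_top
    obtain ⟨n, hn⟩ := hcov z
    refine (hle z n hn).trans ?_
    rw [← ENNReal.ofReal_toReal (h n).ne]
    exact ENNReal.ofReal_le_ofReal ((le_abs_self _).trans (hM ⟨n, rfl⟩))
  · rw [memℓp_toReal_iff h hp0 hpt] at hl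
    rw [eLpNorm_lt_top_iff_lintegral_rpow_enorm_lt_top hp0 hpt]
    simp only [enorm_eq_self]
    have hun : (⋃ n, Metric.ball (a n) (3 * r / 4)) = univ :=
      eq_univ_of_forall fun z => mem_iUnion.2 (hcov z)
    calc ∫⁻ z, μ (Metric.ball z (r / 4)) ^ p.toReal
        = ∫⁻ z in ⋃ n, Metric.ball (a n) (3 * r / 4), μ (Metric.ball z (r / 4)) ^ p.toReal := by
          rw [hun, setLIntegral_univ]
      _ ≤ ∑' n, ∫⁻ z in Metric.ball (a n) (3 * r / 4), μ (Metric.ball z (r / 4)) ^ p.toReal :=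
          lintegral_iUnion_le _ _
      _ ≤ ∑' n, μ (Metric.ball (a n) r) ^ p.toReal *
            volume (Metric.ball (0 : ℂ) (3 * r / 4)) := by
          refine ENNReal.tsum_le_tsum fun n => ?_
          rw [← Measure.addHaar_ball_center _ (a n), ← setLIntegral_const]
          refine setLIntegral_mono measurable_const fun z hz => ?_
          exact ENNReal.rpow_le_rpow (hle z n hz) ENNReal.toReal_nonneg
      _ < ∞ := by
          rw [ENNReal.tsum_mul_right]
          exact ENNReal.mul_lt_top (lt_top_iff_ne_top.2 hl) measure_ball_lt_top

theorem memℓp_lattice_of_eLpNorm [IsLocallyFiniteMeasure μ] (hp : 1 ≤ p) (hr : 0 < r)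
    (ha_inj : Function.Injective a) (ha : Set.range a = lattice r)
    (h : eLpNorm (fun z => μ (Metric.ball z r)) p volume < ∞) :
    Memℓp (fun n => (μ (Metric.ball (a n) r)).toReal) p := by
  have hp0 : p ≠ 0 := (zero_lt_one.trans_le hp).ne'
  by_cases hpt : p = ∞
  · subst hpt
    obtain ⟨M, hM, hle⟩ := exists_measure_ball_le hp hr h
    refine memℓp_infty ⟨M.toReal, ?_⟩
    rintro _ ⟨n, rfl⟩
    simp only [Real.norm_of_nonneg ENNReal.toReal_nonneg]
    exact ENNReal.toReal_mono hM (hle _)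
  · rw [memℓp_toReal_iff (fun n => measure_ball_lt_top) hp0 hpt]
    have h2 := eLpNorm_measure_ball_change (r := 2 * r) hp hr h
    rw [eLpNorm_lt_top_iff_lintegral_rpow_enorm_lt_top hp0 hpt] at h2
    simp only [enorm_eq_self] at h2
    -- Distinct lattice points are at least r apart, so these half-radius balls do not overlap; on
    -- each of them μ(B(z,2r)) dominates μ(B(a_n,r)).
    have hdisj : Pairwise (Function.onFun Disjoint fun n => Metric.ball (a n) (r / 2)) := by
      intro n m hnm
      refine Metric.ball_disjoint_ball ?_
      have := le_dist_of_mem_lattice hr (ha ▸ mem_range_self n) (ha ▸ mem_range_self m)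
        (ha_inj.ne hnm)
      linarith
    have h3 : (∑' n, μ (Metric.ball (a n) r) ^ p.toReal) *
        volume (Metric.ball (0 : ℂ) (r / 2)) ≤
          ∫⁻ z, μ (Metric.ball z (2 * r)) ^ p.toReal := by
      rw [← ENNReal.tsum_mul_right]
      calc ∑' n, μ (Metric.ball (a n) r) ^ p.toReal * volume (Metric.ball (0 : ℂ) (r / 2))
          ≤ ∑' n, ∫⁻ z in Metric.ball (a n) (r / 2), μ (Metric.ball z (2 * r)) ^ p.toReal := by
            refine ENNReal.tsum_le_tsum fun n => ?_
            rw [← Measure.addHaar_ball_center _ (a n), ← setLIntegral_const]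
            refine setLIntegral_mono ((measurable_measure_ball μ _).pow_const _) fun z hz => ?_
            refine ENNReal.rpow_le_rpow (measure_mono (Metric.ball_subset_ball' ?_))
              ENNReal.toReal_nonneg
            rw [Metric.mem_ball, dist_comm] at hz
            linarith
        _ = ∫⁻ z in ⋃ n, Metric.ball (a n) (r / 2), μ (Metric.ball z (2 * r)) ^ p.toReal :=
            (lintegral_iUnion (fun n => measurableSet_ball) hdisj _).symm
        _ ≤ _ := setLIntegral_le_lintegral _ _
    intro htop
    rw [htop, ENNReal.top_mul (volume_ball_ne_zero (by positivity) 0)] at h3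
    exact (h3.trans_lt h2).ne rfl

end Lattice

/-! ### The Berezin transform -/

section Berezin

variable {c α : ℝ}

theorem kernel_eq (c α : ℝ) (z u : ℂ) :
    kernel c α z u = ((2 * (fockKernel α z u).re - c : ℝ) : ℂ) := by
  rw [kernel, Complex.add_conj]
  push_cast
  rfl

theorem fockKernel_self (α : ℝ) (z : ℂ) : fockKernel α z z = (Real.exp (α * ‖z‖ ^ 2) : ℂ) := by
  rw [fockKernel, mul_assoc, mul_comm (conj z), Complex.mul_conj, Complex.normSq_eq_norm_sq]
  push_cast
  rfl

theorem kernel_self_re (c α : ℝ) (z : ℂ) :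
    (kernel c α z z).re = 2 * Real.exp (α * ‖z‖ ^ 2) - c := by
  rw [kernel_eq, fockKernel_self, Complex.ofReal_re, Complex.ofReal_re]

theorem exp_le_kernel_self (hα : 0 < α) (hc : c ≤ 1) (z : ℂ) :
    Real.exp (α * ‖z‖ ^ 2) ≤ (kernel c α z z).re := by
  have : 1 ≤ Real.exp (α * ‖z‖ ^ 2) := Real.one_le_exp (by positivity)
  rw [kernel_self_re]
  linarith

theorem norm_normKernel_sq (hα : 0 < α) (hc : c ≤ 1) (z u : ℂ) :
    ‖normKernel c α z u‖ ^ 2 = ‖kernel c α z u‖ ^ 2 / (kernel c α z z).re := by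
  have := (Real.exp_pos _).trans_le (exp_le_kernel_self hα hc z)
  rw [normKernel, norm_div, div_pow, Complex.norm_real, Real.norm_of_nonneg (Real.sqrt_nonneg _),
    Real.sq_sqrt this.le]

/-- With X = |K_{u+v}(u)| one has H_{u+v}(u) = X (2 cos θ - c/X) for θ = α Im(conj(v) u), and t is
c/X. The sign condition ensures X ≥ 1, hence t ≤ 1. The factor 1/2 comes from H_z(z) ≤ 2 e^{α|z|²}.
-/
theorem le_norm_normKernel_sq_mul_weight (hα : 0 < α) (hc0 : 0 ≤ c) (hc : c ≤ 1) {u v : ℂ}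
    (huv : 0 ≤ (conj v * u).re) :
    ∃ t ∈ Icc (0 : ℝ) 1, weight α v / 2 * (2 * Real.cos (α * (conj v * u).im) - t) ^ 2 ≤
      ‖normKernel c α (u + v) u‖ ^ 2 * weight α u := by
  set X := ‖fockKernel α (u + v) u‖ with hX
  have hXe : X = Real.exp (α * (conj (u + v) * u).re) := by
    rw [hX, fockKernel, Complex.norm_exp, mul_assoc, Complex.re_ofReal_mul]
  have huu : (conj (u + v) * u).re = ‖u‖ ^ 2 + (conj v * u).re := by
    rw [map_add, add_mul, Complex.add_re, mul_comm (conj u), Complex.mul_conj,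
      Complex.normSq_eq_norm_sq, Complex.ofReal_re]
  have hui : (conj (u + v) * u).im = (conj v * u).im := by
    rw [map_add, add_mul, Complex.add_im, mul_comm (conj u), Complex.mul_conj, Complex.ofReal_im,
      zero_add]
  have hX1 : 1 ≤ X := by
    rw [hXe, huu]
    exact Real.one_le_exp (by positivity)
  have hX0 : 0 < X := by linarith
  have hre : (fockKernel α (u + v) u).re = X * Real.cos (α * (conj v * u).im) := by
    rw [fockKernel, Complex.exp_re, hXe, mul_assoc, Complex.re_ofReal_mul, Complex.im_ofReal_mul,
      hui]
  have hk : ‖kernel c α (u + v) u‖ ^ 2 =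
      X ^ 2 * (2 * Real.cos (α * (conj v * u).im) - c / X) ^ 2 := by
    rw [kernel_eq, Complex.norm_real, Real.norm_eq_abs, sq_abs, hre]
    field_simp
  have hw : X ^ 2 * weight α u = weight α v * Real.exp (α * ‖u + v‖ ^ 2) := by
    rw [hX, norm_fockKernel_sq_mul_weight, sub_add_cancel_left]
    simp [weight]
  have hE := Real.exp_pos (α * ‖u + v‖ ^ 2)
  have hD := exp_le_kernel_self hα hc (u + v)
  have hD2 : (kernel c α (u + v) (u + v)).re ≤ 2 * Real.exp (α * ‖u + v‖ ^ 2) := by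
    rw [kernel_self_re]; linarith
  refine ⟨c / X, ⟨by positivity, (div_le_one hX0).2 (by linarith)⟩, ?_⟩
  rw [norm_normKernel_sq hα hc, div_mul_eq_mul_div (‖kernel c α (u + v) u‖ ^ 2),
    le_div_iff₀ (hE.trans_le hD), hk,
    mul_right_comm (X ^ 2), hw]
  have hwv := weight_pos α v
  set T := (2 * Real.cos (α * (conj v * u).im) - c / X) ^ 2
  calc weight α v / 2 * T * (kernel c α (u + v) (u + v)).re
      ≤ weight α v / 2 * T * (2 * Real.exp (α * ‖u + v‖ ^ 2)) := by
        gcongr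
    _ = _ := by ring

/-- The first term can be small only if cos θ is roughly between 0 and 1/2; then cos 2θ is negative
and bounded away from 0, while t ≥ 0. -/
theorem doubling_lower_bound (θ : ℝ) {s t : ℝ} (hs : s ∈ Icc (0 : ℝ) 1) (ht : t ∈ Icc (0 : ℝ) 1) :
    1 / 16 ≤ (2 * Real.cos θ - s) ^ 2 + (2 * Real.cos (2 * θ) - t) ^ 2 := by
  rw [Real.cos_two_mul]
  set x := Real.cos θ
  obtain ⟨hs0, hs1⟩ := hs
  obtain ⟨ht0, ht1⟩ := ht
  by_cases h1 : 5 / 8 ≤ x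
  · have : (1 / 4) ^ 2 ≤ (2 * x - s) ^ 2 := pow_le_pow_left₀ (by norm_num) (by linarith) 2
    nlinarith [sq_nonneg (2 * (2 * x ^ 2 - 1) - t)]
  by_cases h2 : x ≤ -1 / 4
  · have : (1 / 4) ^ 2 ≤ (s - 2 * x) ^ 2 := pow_le_pow_left₀ (by norm_num) (by linarith) 2
    nlinarith [sq_nonneg (2 * (2 * x ^ 2 - 1) - t)]
  · have h3 : 4 * x ^ 2 ≤ 25 / 16 := by
      have : x ^ 2 ≤ (5 / 8) ^ 2 := sq_le_sq' (by linarith) (by linarith)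
      linarith
    have : (1 / 4) ^ 2 ≤ (t - 2 * (2 * x ^ 2 - 1)) ^ 2 :=
      pow_le_pow_left₀ (by norm_num) (by linarith) 2
    nlinarith [sq_nonneg (2 * x - s)]

variable (c α) in
/-- The integrand `|h_z(u)|² e^{-α|u|²}` of the Berezin transform. -/
def berezinKernel (z u : ℂ) : ℝ≥0∞ :=
  ENNReal.ofReal (‖normKernel c α z u‖ ^ 2 * weight α u)

theorem berezin_eq (μ : Measure ℂ) (z : ℂ) : berezin c α μ z = ∫⁻ u, berezinKernel c α z u ∂μ := rfl

theorem continuous_kernel_uncurry (c α : ℝ) : Continuous fun x : ℂ × ℂ => kernel c α x.1 x.2 := by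
  unfold kernel fockKernel
  fun_prop

theorem continuous_berezinKernel (hα : 0 < α) (hc : c ≤ 1) :
    Continuous fun x : ℂ × ℂ => berezinKernel c α x.1 x.2 := by
  have hk := continuous_kernel_uncurry c α
  have hkk : Continuous fun x : ℂ × ℂ => (kernel c α x.1 x.1).re :=
    Complex.continuous_re.comp (hk.comp (continuous_fst.prodMk continuous_fst))
  unfold berezinKernel
  simp only [norm_normKernel_sq hα hc]
  refine ENNReal.continuous_ofReal.comp (Continuous.mul (Continuous.div (hk.norm.pow 2) hkk
    fun x => ?_) (by fun_prop))
  exact ((Real.exp_pos _).trans_le (exp_le_kernel_self hα hc x.1)).ne'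

theorem measurable_berezin (hα : 0 < α) (hc : c ≤ 1) (μ : Measure ℂ) :
    Measurable (berezin c α μ) := by
  have h := continuous_berezinKernel hα hc
  refine (lowerSemicontinuous_lintegral (Φ := berezinKernel c α) (fun z => ?_) fun u => ?_).measurable
  · exact (h.comp (continuous_const.prodMk continuous_id)).measurable
  · exact (h.comp (continuous_id.prodMk continuous_const)).lowerSemicontinuous

theorem exists_unit_mul (u : ℂ) : ∃ e : ℂ, ‖e‖ = 1 ∧ u = ‖u‖ * e := by
  by_cases hu : u = 0
  · exact ⟨1, by simp, by simp [hu]⟩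
  · have : (‖u‖ : ℂ) ≠ 0 := by simpa using hu
    refine ⟨u / ‖u‖, ?_, by field_simp⟩
    rw [norm_div, Complex.norm_real, norm_norm, div_self (by simpa using hu)]

theorem setLIntegral_ball_translate (F : ℂ → ℝ≥0∞) (z : ℂ) (R : ℝ) :
    ∫⁻ w in Metric.ball 0 R, F (z + w) = ∫⁻ x in Metric.ball z R, F x := by
  rw [← lintegral_indicator measurableSet_ball, ← lintegral_indicator measurableSet_ball,
    ← lintegral_add_left_eq_self (indicator (Metric.ball z _) _) z]
  refine lintegral_congr fun v => ?_
  simp [indicator]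

theorem lintegral_comp_two_smul (g : ℂ → ℝ≥0∞) (hg : Measurable g) :
    ∫⁻ v : ℂ, g ((2 : ℝ) • v) ≤ ∫⁻ v, g v := by
  rw [← lintegral_map hg (measurable_const_smul (2 : ℝ)),
    Measure.map_addHaar_smul volume two_ne_zero, lintegral_smul_measure, smul_eq_mul]
  refine mul_le_of_le_one_left' ?_
  rw [Complex.finrank_real_complex]
  exact ENNReal.ofReal_le_one.2 (by norm_num [abs_of_pos])

/-- This replaces the pointwise lower bound that fails because H_z(u) can vanish: the kernel at u +
v plus the kernel at u + 2v is bounded below on a ball of v, and the two integrals are compared by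
scaling. -/
theorem exists_one_le_lintegral_berezinKernel (hα : 0 < α) (hc0 : 0 ≤ c) (hc : c ≤ 1) {ρ : ℝ}
    (hρ : 0 < ρ) :
    ∃ C : ℝ≥0∞, C ≠ ∞ ∧ ∀ u, 1 ≤ C * ∫⁻ z in Metric.ball u ρ, berezinKernel c α z u := by
  set δ := ENNReal.ofReal (Real.exp (-α * ρ ^ 2) / 2 * (1 / 16)) with hδ
  have hδ0 : δ ≠ 0 := by
    simp only [hδ, ne_eq, ENNReal.ofReal_eq_zero, not_le]; positivity
  set V := volume (Metric.ball (0 : ℂ) (ρ / 4)) with hV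
  have hV0 : V ≠ 0 := volume_ball_ne_zero (by positivity) 0
  have hVt : V ≠ ∞ := measure_ball_lt_top.ne
  have hδV : δ * V ≠ 0 := mul_ne_zero hδ0 hV0
  refine ⟨(δ * V)⁻¹ * 2, ENNReal.mul_ne_top (by simpa using ⟨hδ0, hV0⟩) (by simp), fun u => ?_⟩
  have hcont := continuous_berezinKernel hα hc
  have hm : Measurable fun v => berezinKernel c α (u + v) u :=
    (hcont.comp ((continuous_const.add continuous_id).prodMk continuous_const)).measurable
  set g : ℂ → ℝ≥0∞ := (Metric.ball 0 ρ).indicator fun v => berezinKernel c α (u + v) u with hg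
  have hgm : Measurable g := hm.indicator measurableSet_ball
  have hgint : ∫⁻ v, g v = ∫⁻ z in Metric.ball u ρ, berezinKernel c α z u := by
    rw [hg, lintegral_indicator measurableSet_ball,
      setLIntegral_ball_translate (fun z => berezinKernel c α z u)]
  obtain ⟨e, he, hue⟩ := exists_unit_mul u
  -- The ball touches the origin and is centred in the direction of u, so Re(conj(v) u) ≥ 0 on it,
  -- and its dilate by 2 stays inside B(0,ρ).
  have hpt : ∀ v ∈ Metric.ball (((ρ / 4 : ℝ) : ℂ) * e) (ρ / 4), δ ≤ g v + g ((2 : ℝ) • v) := by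
    intro v hv
    rw [Metric.mem_ball, dist_eq_norm] at hv
    have hvn : ‖v‖ < ρ / 2 := by
      have h1 := norm_le_norm_add_norm_sub' v (((ρ / 4 : ℝ) : ℂ) * e)
      rw [norm_mul, he, Complex.norm_real, Real.norm_of_nonneg (by positivity)] at h1
      linarith
    have hre : 0 ≤ (conj v * u).re := by
      have h1 : (conj v * e).re = ρ / 4 + (conj (v - ((ρ / 4 : ℝ) : ℂ) * e) * e).re := by
        rw [map_sub, map_mul, Complex.conj_ofReal, sub_mul, mul_assoc _ (conj e), mul_comm (conj e),
          Complex.mul_conj, Complex.normSq_eq_norm_sq, he, Complex.sub_re,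
          Complex.re_ofReal_mul]
        simp
      have h2 := Complex.abs_re_le_norm (conj (v - ((ρ / 4 : ℝ) : ℂ) * e) * e)
      rw [norm_mul, he, mul_one, RCLike.norm_conj] at h2
      have h3 := (abs_le.1 h2).1
      rw [hue, mul_left_comm, Complex.re_ofReal_mul]
      exact mul_nonneg (norm_nonneg _) (by linarith)
    have hre2 : 0 ≤ (conj ((2 : ℝ) • v) * u).re := by
      simp only [Complex.real_smul, map_mul, Complex.conj_ofReal, mul_assoc,
        Complex.re_ofReal_mul]
      linarith
    have him2 : (conj ((2 : ℝ) • v) * u).im = 2 * (conj v * u).im := by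
      simp only [Complex.real_smul, map_mul, Complex.conj_ofReal, mul_assoc,
        Complex.im_ofReal_mul]
    have hn2 : ‖(2 : ℝ) • v‖ = 2 * ‖v‖ := by rw [norm_smul]; simp
    obtain ⟨s, hs, h1⟩ := le_norm_normKernel_sq_mul_weight (c := c) hα hc0 hc hre
    obtain ⟨t, ht, h2⟩ := le_norm_normKernel_sq_mul_weight (c := c) hα hc0 hc hre2
    rw [him2, mul_left_comm] at h2
    have h3 := doubling_lower_bound (α * (conj v * u).im) hs ht
    have hw1 : Real.exp (-α * ρ ^ 2) ≤ weight α v := by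
      refine Real.exp_le_exp.2 ?_
      have := pow_le_pow_left₀ (norm_nonneg v) (by linarith : ‖v‖ ≤ ρ) 2
      nlinarith
    have hw2 : Real.exp (-α * ρ ^ 2) ≤ weight α ((2 : ℝ) • v) := by
      refine Real.exp_le_exp.2 ?_
      have := pow_le_pow_left₀ (norm_nonneg _) (by linarith : ‖(2 : ℝ) • v‖ ≤ ρ) 2
      nlinarith
    have e1 : g v = berezinKernel c α (u + v) u :=
      indicator_of_mem (by rw [mem_ball_zero_iff]; linarith) _
    have e2 : g ((2 : ℝ) • v) = berezinKernel c α (u + (2 : ℝ) • v) u :=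
      indicator_of_mem (by rw [mem_ball_zero_iff]; linarith) _
    rw [e1, e2, berezinKernel, berezinKernel, ← ENNReal.ofReal_add
      (mul_nonneg (sq_nonneg _) (weight_pos _ _).le) (mul_nonneg (sq_nonneg _) (weight_pos _ _).le)]
    refine ENNReal.ofReal_le_ofReal (le_trans ?_ (add_le_add h1 h2))
    calc Real.exp (-α * ρ ^ 2) / 2 * (1 / 16)
        ≤ Real.exp (-α * ρ ^ 2) / 2 * ((2 * Real.cos (α * (conj v * u).im) - s) ^ 2 +
          (2 * Real.cos (2 * (α * (conj v * u).im)) - t) ^ 2) := by gcongr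
      _ ≤ _ := by rw [mul_add]; gcongr
  have key : δ * V ≤ 2 * ∫⁻ v, g v := by
    calc δ * V = ∫⁻ _ in Metric.ball (((ρ / 4 : ℝ) : ℂ) * e) (ρ / 4), δ := by
          rw [setLIntegral_const, Measure.addHaar_ball_center]
      _ ≤ ∫⁻ v in Metric.ball (((ρ / 4 : ℝ) : ℂ) * e) (ρ / 4), g v + g ((2 : ℝ) • v) :=
          setLIntegral_mono (hgm.add (hgm.comp (measurable_const_smul (2 : ℝ)))) hpt
      _ ≤ ∫⁻ v, g v + g ((2 : ℝ) • v) := setLIntegral_le_lintegral _ _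
      _ = (∫⁻ v, g v) + ∫⁻ v : ℂ, g ((2 : ℝ) • v) := lintegral_add_left hgm _
      _ ≤ 2 * ∫⁻ v, g v := by
          rw [two_mul]
          exact add_le_add_right (lintegral_comp_two_smul g hgm) _
  rw [← hgint, mul_assoc]
  calc (1 : ℝ≥0∞) = (δ * V)⁻¹ * (δ * V) :=
        (ENNReal.inv_mul_cancel hδV (ENNReal.mul_ne_top (by simp [hδ]) hVt)).symm
    _ ≤ _ := by gcongr

/-- The integrand is continuous and positive at (u, u), hence bounded below on a product of
neighbourhoods; some z near u has a finite Berezin transform. -/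
theorem isLocallyFiniteMeasure_of_berezin (hα : 0 < α) (hc : c ≤ 1) {μ : Measure ℂ}
    {p : ℝ≥0∞} (hp : 1 ≤ p) (h : eLpNorm (berezin c α μ) p volume < ∞) :
    IsLocallyFiniteMeasure μ := by
  refine ⟨fun u => ?_⟩
  have hcont := continuous_berezinKernel hα hc
  have hpos : 0 < berezinKernel c α u u := by
    have h1 := (Real.exp_pos _).trans_le (exp_le_kernel_self hα hc u)
    have h2 : kernel c α u u ≠ 0 := fun h0 => by simp [h0] at h1
    rw [berezinKernel, norm_normKernel_sq hα hc, ENNReal.ofReal_pos]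
    have := weight_pos α u
    positivity
  obtain ⟨ε, hε0, hε⟩ := exists_between hpos
  have hopen : IsOpen {x : ℂ × ℂ | ε < berezinKernel c α x.1 x.2} :=
    isOpen_lt continuous_const hcont
  obtain ⟨U, V, hU, hV, huU, huV, hUV⟩ := isOpen_prod_iff.1 hopen u u hε
  obtain ⟨z, hz, hlt⟩ := exists_mem_ball_lt_top (measurable_berezin hα hc μ) hp h hU ⟨u, huU⟩
  refine ⟨V, hV.mem_nhds huV, ?_⟩
  have h3 : ε * μ V ≤ berezin c α μ z := by
    rw [← setLIntegral_const]
    refine (setLIntegral_mono' hV.measurableSet fun w hw => ?_).trans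
      (setLIntegral_le_lintegral V _)
    exact (hUV (mk_mem_prod hz hw)).le
  by_contra htop
  rw [not_lt, top_le_iff] at htop
  rw [htop, ENNReal.mul_top hε0.ne'] at h3
  exact (h3.trans_lt hlt).ne rfl

theorem eLpNorm_measure_ball_of_berezin (hα : 0 < α) (hc0 : 0 ≤ c) (hc : c ≤ 1)
    {μ : Measure ℂ} [IsLocallyFiniteMeasure μ] {p : ℝ≥0∞} (hp : 1 ≤ p) {ρ : ℝ} (hρ : 0 < ρ)
    (h : eLpNorm (berezin c α μ) p volume < ∞) :
    eLpNorm (fun z => μ (Metric.ball z ρ)) p volume < ∞ := by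
  obtain ⟨C, hC, hCle⟩ := exists_one_le_lintegral_berezinKernel hα hc0 hc hρ
  have := isFiniteMeasure_restrict.2
    (measure_ball_lt_top (μ := (volume : Measure ℂ)) (x := 0) (r := 2 * ρ)).ne
  have : IsFiniteMeasure (C • (volume : Measure ℂ).restrict (Metric.ball 0 (2 * ρ))) :=
    Measure.smul_finite _ hC
  have hcont := continuous_berezinKernel hα hc
  refine eLpNorm_lt_top_of_le_translates (measurable_berezin hα hc μ) hp
    (C • (volume : Measure ℂ).restrict (Metric.ball 0 (2 * ρ))) (fun z => ?_) h
  rw [lintegral_smul_measure, smul_eq_mul]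
  rw [setLIntegral_ball_translate]
  have hm1 : Measurable fun u => ∫⁻ x in Metric.ball z (2 * ρ), berezinKernel c α x u := by
    have : Measurable fun y : ℂ × ℂ => berezinKernel c α y.2 y.1 :=
      (hcont.comp continuous_swap).measurable
    exact this.lintegral_prod_right'
  calc μ (Metric.ball z ρ) = ∫⁻ _ in Metric.ball z ρ, 1 ∂μ := by rw [setLIntegral_one]
    -- For u in B(z,ρ) the ball B(u,ρ) lies in B(z,2ρ), so the outer domain no longer depends on u
    -- and Tonelli applies.
    _ ≤ ∫⁻ u in Metric.ball z ρ, (C * ∫⁻ x in Metric.ball z (2 * ρ), berezinKernel c α x u) ∂μ := by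
        refine setLIntegral_mono (hm1.const_mul C) fun u hu => (hCle u).trans ?_
        gcongr
        refine Metric.ball_subset_ball' ?_
        rw [Metric.mem_ball] at hu
        linarith
    _ ≤ ∫⁻ u, (C * ∫⁻ x in Metric.ball z (2 * ρ), berezinKernel c α x u) ∂μ :=
        setLIntegral_le_lintegral _ _
    _ = C * ∫⁻ x in Metric.ball z (2 * ρ), berezin c α μ x := by
        rw [lintegral_const_mul _ hm1, lintegral_lintegral_swap]
        · rfl
        · exact (hcont.comp continuous_swap).measurable.aemeasurable

end Berezin

/-! ### Singular value decompositions and Schatten classes -/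

section Operator

variable {E : Type} [NormedAddCommGroup E] [InnerProductSpace ℂ E] [CompleteSpace E]

/-- T is the norm limit of the finite-rank operators T P, with P the projection onto V. -/
theorem isCompactOperator_of_small_on_orthogonal {T : E →L[ℂ] E}
    (h : ∀ ε : ℝ, 0 < ε → ∃ V : Submodule ℂ E, FiniteDimensional ℂ V ∧
      ∀ x ∈ Vᗮ, ‖T x‖ ≤ ε * ‖x‖) : IsCompactOperator T := by
  have hpos : ∀ n : ℕ, (0 : ℝ) < 1 / (n + 1) := fun n => Nat.one_div_pos_of_nat
  choose V hfd hV using fun n : ℕ => h (1 / (n + 1)) (hpos n)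
  refine isCompactOperator_of_tendsto (l := Filter.atTop)
    (F := fun n => T ∘L (V n).starProjection) ?_ (Filter.Eventually.of_forall fun n => ?_)
  · rw [tendsto_iff_norm_sub_tendsto_zero]
    refine squeeze_zero (fun n => norm_nonneg _) (fun n => ?_)
      tendsto_one_div_add_atTop_nhds_zero_nat
    refine ContinuousLinearMap.opNorm_le_bound _ (hpos n).le fun x => ?_
    have h1 : ((T ∘L (V n).starProjection - T) x : E) = -T (x - (V n).starProjection x) := by
      simp
    rw [h1, norm_neg]
    refine (hV n _ (Submodule.sub_starProjection_mem_orthogonal x)).trans ?_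
    gcongr
    have h2 : x - (V n).starProjection x = (V n)ᗮ.starProjection x := by
      rw [Submodule.starProjection_orthogonal_val]
    rw [h2]
    exact Submodule.norm_starProjection_apply_le _ x
  · have := FiniteDimensional.proper ℂ (V n)
    have h1 : IsCompactOperator (V n).orthogonalProjectionOnto :=
      isCompactOperator_of_locallyCompactSpace_dom _
    exact h1.clm_comp (T ∘L (V n).subtypeL)

/-- Otherwise there are orthonormal x_n with ‖T x_n‖ > ε and pairwise orthogonal images: each is
chosen orthogonal to all earlier x and T*T x. Testing against the normalized images gives N ε^q ≤ M
for every N. -/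
theorem isCompactOperator_of_sum_le {T : E →L[ℂ] E} {q : ℝ} (hq : 0 < q) {M : ℝ}
    (h : ∀ (ι : Type) [Fintype ι] (e f : ι → E), Orthonormal ℂ e → Orthonormal ℂ f →
      ∑ i, ‖(inner ℂ (f i) (T (e i)) : ℂ)‖ ^ q ≤ M) : IsCompactOperator T := by
  refine isCompactOperator_of_small_on_orthogonal fun ε hε => ?_
  by_contra hcon
  push Not at hcon
  obtain ⟨x, hx, hxo⟩ := exists_seq_of_forall_finset_exists
    (fun x : E => ‖x‖ = 1 ∧ ε < ‖T x‖)
    (fun x y => (inner ℂ x y : ℂ) = 0 ∧ (inner ℂ (T x) (T y) : ℂ) = 0) (fun s _ => by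
      classical
      obtain ⟨y, hy, hTy⟩ := hcon (Submodule.span ℂ
        ((s ∪ s.image (fun x => ContinuousLinearMap.adjoint T (T x)) : Finset E) : Set E))
        inferInstance
      have hy0 : 0 < ‖y‖ := by
        rw [norm_pos_iff]
        rintro rfl
        simp at hTy
      rw [Submodule.mem_orthogonal] at hy
      have hc : ‖((‖y‖⁻¹ : ℝ) : ℂ)‖ = ‖y‖⁻¹ := by
        rw [Complex.norm_real, Real.norm_of_nonneg (by positivity)]
      refine ⟨((‖y‖⁻¹ : ℝ) : ℂ) • y, ⟨?_, ?_⟩, fun x hx => ⟨?_, ?_⟩⟩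
      · rw [norm_smul, hc, inv_mul_cancel₀ hy0.ne']
      · rw [map_smul, norm_smul, hc, ← div_eq_inv_mul, lt_div_iff₀ hy0]
        exact hTy
      · rw [inner_smul_right, hy x (Submodule.subset_span (by simp [hx])), mul_zero]
      · rw [map_smul, inner_smul_right, ← ContinuousLinearMap.adjoint_inner_left,
          hy _ (Submodule.subset_span (by
            simp only [Finset.coe_union, Finset.coe_image, mem_union, mem_image, Finset.mem_coe]
            exact Or.inr ⟨x, hx, rfl⟩)), mul_zero])
  have horth : ∀ m n, m ≠ n → (inner ℂ (x m) (x n) : ℂ) = 0 ∧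
      (inner ℂ (T (x m)) (T (x n)) : ℂ) = 0 := by
    intro m n hmn
    rcases lt_or_gt_of_ne hmn with hlt | hlt
    · exact hxo m n hlt
    · obtain ⟨h1, h2⟩ := hxo n m hlt
      exact ⟨inner_eq_zero_symm.1 h1, inner_eq_zero_symm.1 h2⟩
  obtain ⟨N, hN⟩ := exists_nat_gt (M / ε ^ q)
  have hεq : 0 < ε ^ q := Real.rpow_pos_of_pos hε q
  rw [div_lt_iff₀ hεq] at hN
  have hT0 : ∀ n, 0 < ‖T (x n)‖ := fun n => hε.trans (hx n).2
  have h2 := h (Fin N) (fun i => x i) (fun i => ((‖T (x i)‖⁻¹ : ℝ) : ℂ) • T (x i))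
    ⟨fun i => (hx i).1, fun i j hij => (horth i j (fun h => hij (Fin.ext h))).1⟩
    ⟨fun i => by
      rw [norm_smul, Complex.norm_real, Real.norm_of_nonneg (by positivity),
        inv_mul_cancel₀ (hT0 i).ne'],
    fun i j hij => by
      dsimp only
      rw [inner_smul_left, inner_smul_right, (horth i j (fun h => hij (Fin.ext h))).2]
      simp⟩
  have h3 : ∀ i : Fin N, ε ^ q ≤ ‖(inner ℂ (((‖T (x i)‖⁻¹ : ℝ) : ℂ) • T (x i)) (T (x i)) : ℂ)‖ ^ q := by
    intro i
    refine Real.rpow_le_rpow hε.le ?_ hq.le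
    rw [inner_smul_left, norm_mul, RCLike.norm_conj, Complex.norm_real,
      Real.norm_of_nonneg (by positivity), inner_self_eq_norm_sq_to_K, norm_pow]
    simp only [Complex.coe_algebraMap, Complex.norm_real, norm_norm]
    rw [sq, inv_mul_cancel_left₀ (hT0 i).ne']
    exact (hx i).2.le
  have h4 : (N : ℝ) * ε ^ q ≤ M := by
    refine le_trans ?_ h2
    calc (N : ℝ) * ε ^ q = ∑ _i : Fin N, ε ^ q := by simp
      _ ≤ _ := Finset.sum_le_sum fun i _ => h3 i
  linarith

/-- Orthonormal bases of all eigenspaces are joined by the spectral theorem. Hilbert bases are used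
because the kernel of A may be infinite-dimensional. -/
theorem exists_hilbertBasis_eigenvectors {A : E →L[ℂ] E} (hA : IsCompactOperator A)
    (hs : A.IsSymmetric) :
    ∃ (κ : Type) (b : HilbertBasis κ ℂ E) (m : κ → ℂ), ∀ k, A (b k) = m k • b k := by
  set V : ℂ → Submodule ℂ E := fun μ => Module.End.eigenspace (A : Module.End ℂ E) μ with hVdef
  have hclosed : ∀ μ, IsClosed (V μ : Set E) := fun μ => by
    have : (V μ : Set E) = {x | A x = μ • x} := by
      ext x
      exact Module.End.mem_eigenspace_iff
    rw [this]
    exact isClosed_eq A.continuous (continuous_const_smul μ)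
  have hcomp : ∀ μ, CompleteSpace (V μ) := fun μ => (hclosed μ).completeSpace_coe
  choose w b hb using fun μ => exists_hilbertBasis ℂ (V μ)
  have hv : Orthonormal ℂ fun a : Σ μ, w μ => ((b a.1 a.2 : V a.1) : E) :=
    hs.orthogonalFamily_eigenspaces.orthonormal_sigma_orthonormal
      (v_family := fun μ => b μ) fun μ => (b μ).orthonormal
  have hspan : (Submodule.span ℂ (range fun a : Σ μ, w μ => ((b a.1 a.2 : V a.1) : E)))ᗮ = ⊥ := by
    rw [← ContinuousLinearMap.orthogonalComplement_iSup_eigenspaces_eq_bot hA hs]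
    refine le_antisymm (fun x hx => ?_) (Submodule.orthogonal_le ?_)
    · rw [← Submodule.iInf_orthogonal, Submodule.mem_iInf]
      intro μ
      rw [Submodule.mem_orthogonal']
      intro y hy
      have h1 : HasSum (fun i => (b μ).repr ⟨y, hy⟩ i • ((b μ i : V μ) : E)) y :=
        ((b μ).hasSum_repr ⟨y, hy⟩).mapL (V μ).subtypeL
      have h2 := h1.mapL (innerSL ℂ x)
      have h3 : ∀ i, innerSL ℂ x ((b μ).repr ⟨y, hy⟩ i • ((b μ i : V μ) : E)) = 0 := fun i => by
        rw [Submodule.mem_orthogonal'] at hx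
        have := hx _ (Submodule.subset_span ⟨⟨μ, i⟩, rfl⟩)
        rw [map_smul, innerSL_apply_apply, this, smul_zero]
      simp only [h3] at h2
      exact h2.unique hasSum_zero
    · rw [Submodule.span_le]
      rintro _ ⟨a, rfl⟩
      exact Submodule.mem_iSup_of_mem a.1 (b a.1 a.2).2
  refine ⟨_, HilbertBasis.mkOfOrthogonalEqBot hv hspan, fun a => a.1, fun a => ?_⟩
  rw [HilbertBasis.coe_mkOfOrthogonalEqBot]
  exact Module.End.mem_eigenspace_iff.1 (b a.1 a.2).2

/-- The singular value decomposition of a compact operator. -/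
theorem exists_singular_value_decomposition {T : E →L[ℂ] E} (hT : IsCompactOperator T) :
    ∃ (ι : Type) (e f : ι → E) (s : ι → ℝ), Orthonormal ℂ e ∧ Orthonormal ℂ f ∧
      (∀ i, 0 ≤ s i) ∧ (∀ i, inner ℂ (f i) (T (e i)) = (s i : ℂ)) ∧
      ∀ x, HasSum (fun i => ((s i : ℂ) * inner ℂ (e i) x) • f i) (T x) := by
  set A := ContinuousLinearMap.adjoint T ∘L T with hA
  have hAc : IsCompactOperator A := hT.clm_comp (ContinuousLinearMap.adjoint T)
  have hsa : IsSelfAdjoint A := by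
    rw [ContinuousLinearMap.isSelfAdjoint_iff', hA, ContinuousLinearMap.adjoint_comp,
      ContinuousLinearMap.adjoint_adjoint]
  obtain ⟨κ, b, m, hb⟩ := exists_hilbertBasis_eigenvectors hAc hsa.isSymmetric
  have horth : ∀ i j, i ≠ j → (inner ℂ (T (b i)) (T (b j)) : ℂ) = 0 := fun i j hij => by
    rw [← ContinuousLinearMap.adjoint_inner_right]
    have h1 : ContinuousLinearMap.adjoint T (T (b j)) = m j • b j := hb j
    rw [h1, inner_smul_right, b.orthonormal.2 hij, mul_zero]
  have hpos : ∀ i : {k // T (b k) ≠ 0}, 0 < ‖T (b i)‖ := fun i => norm_pos_iff.2 i.2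
  -- The e_i are the eigenvectors of T*T outside ker T. Their images are orthogonal, and normalizing
  -- these gives the f_i, with s_i = ‖T e_i‖.
  refine ⟨{k // T (b k) ≠ 0}, fun i => b i, fun i => ((‖T (b i)‖⁻¹ : ℝ) : ℂ) • T (b i),
    fun i => ‖T (b i)‖, b.orthonormal.comp _ Subtype.val_injective, ⟨fun i => ?_, fun i j hij => ?_⟩,
    fun i => norm_nonneg _, fun i => ?_, fun x => ?_⟩
  · rw [norm_smul, Complex.norm_real, Real.norm_of_nonneg (by positivity),
      inv_mul_cancel₀ (hpos i).ne']
  · dsimp only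
    rw [inner_smul_left, inner_smul_right, horth _ _ (fun h => hij (Subtype.ext h))]
    simp
  · rw [inner_smul_left, inner_self_eq_norm_sq_to_K, Complex.conj_ofReal]
    have : (‖T (b i)‖ : ℂ) ≠ 0 := by exact_mod_cast (hpos i).ne'
    simp only [Complex.coe_algebraMap]
    push_cast
    field_simp
  · have h1 : HasSum (fun k => b.repr x k • T (b k)) (T x) := by
      simpa using (b.hasSum_repr x).mapL T
    have hsupp : Function.support (fun k => b.repr x k • T (b k)) ⊆ {k | T (b k) ≠ 0} := by
      intro k hk h0
      exact hk (by simp [h0])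
    have h2 : (fun i : {k // T (b k) ≠ 0} => ((‖T (b i)‖ : ℂ) * inner ℂ (b i) x) •
        (((‖T (b i)‖⁻¹ : ℝ) : ℂ) • T (b i))) =
        (fun k => b.repr x k • T (b k)) ∘ ((↑) : {k | T (b k) ≠ 0} → κ) := by
      ext i
      have : (‖T (b i)‖ : ℂ) ≠ 0 := by exact_mod_cast (hpos i).ne'
      rw [smul_smul, Function.comp_apply, b.repr_apply_apply]
      congr 1
      push_cast
      field_simp
    rw [h2]
    exact (hasSum_subtype_iff_of_support_subset hsupp).2 h1

theorem isSchatten_of_sum_le {T : E →L[ℂ] E} {p : ℝ≥0∞} (hp0 : p ≠ 0) (hpt : p ≠ ∞) {M : ℝ}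
    (h : ∀ (ι : Type) [Fintype ι] (e f : ι → E), Orthonormal ℂ e → Orthonormal ℂ f →
      ∑ i, ‖(inner ℂ (f i) (T (e i)) : ℂ)‖ ^ p.toReal ≤ M) : IsSchatten p T := by
  have hq := ENNReal.toReal_pos hp0 hpt
  obtain ⟨ι, e, f, s, he, hf, hs, hfe, hsum⟩ :=
    exists_singular_value_decomposition (isCompactOperator_of_sum_le hq h)
  refine Or.inr ⟨ι, e, f, s, he, hf, hs, memℓp_gen' (C := M) fun S => ?_, hsum⟩
  have h2 := h S (fun i => e i) (fun i => f i) (he.comp _ Subtype.val_injective)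
    (hf.comp _ Subtype.val_injective)
  simp only [hfe, Complex.norm_real] at h2
  rwa [Finset.sum_coe_sort S (fun i => ‖s i‖ ^ p.toReal)] at h2

end Operator

/-! ### Reproducing kernels and point evaluations -/

section Toeplitz

variable {α : ℝ} [Fact (0 < α)]

variable (α) in
/-- The reproducing kernel of the harmonic Fock space. -/
def harmKernel (z : ℂ) : HarmonicFock α := holKernel α z + antiKernel α z

theorem inner_harmKernel (f : HarmonicFock α) (z : ℂ) : inner ℂ (harmKernel α z) f = f z := by
  rw [harmKernel, inner_add_left, ← f.apply_eq]

theorem harmKernel_apply (z w : ℂ) :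
    harmKernel α z w = fockKernel α z w + (conj (fockKernel α z w) - 1) := rfl

theorem norm_harmKernel_sq_le (z : ℂ) : ‖harmKernel α z‖ ^ 2 ≤ 4 * Real.exp (α * ‖z‖ ^ 2) := by
  have h1 := norm_holKernel_sq (α := α) z
  have h2 := norm_antiKernel_sq_le (α := α) z
  have h3 := norm_add_le (holKernel α z) (antiKernel α z)
  have h4 := pow_le_pow_left₀ (norm_nonneg _) h3 2
  rw [harmKernel]
  nlinarith [sq_nonneg (‖holKernel α z‖ - ‖antiKernel α z‖)]

theorem antiKernel_zero : antiKernel α 0 = 0 := by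
  refine Subtype.ext (funext fun w => ?_)
  change conj (fockKernel α 0 w) - 1 = 0
  simp [fockKernel_zero_left]

theorem inner_holKernel_zero (f : HarmonicFock α) : inner ℂ (holKernel α 0) f = f 0 := by
  rw [f.apply_eq 0, antiKernel_zero, inner_zero_left, add_zero]

theorem norm_holKernel_zero : ‖holKernel α 0‖ = 1 := by
  have h := norm_holKernel_sq (α := α) 0
  simp only [norm_zero, ne_eq, OfNat.ofNat_ne_zero, not_false_eq_true, zero_pow, mul_zero,
    Real.exp_zero] at h
  exact (pow_eq_one_iff_of_nonneg (norm_nonneg _) two_ne_zero).1 h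

variable (α) in
/-- The operator `f ↦ f + (1 - c) f(0)`. -/
def constShift (c : ℝ) : HarmonicFock α →L[ℂ] HarmonicFock α :=
  ContinuousLinearMap.id ℂ _ +
    ((1 - c : ℝ) : ℂ) • (innerSL ℂ (holKernel α 0)).smulRight (holKernel α 0)

theorem constShift_apply (c : ℝ) (f : HarmonicFock α) :
    constShift α c f = f + ((1 - c : ℝ) : ℂ) • (inner ℂ (holKernel α 0) f : ℂ) • holKernel α 0 :=
  rfl

theorem constShift_one : constShift α 1 = ContinuousLinearMap.id ℂ _ := by
  simp [constShift]

theorem inner_constShift_left (c : ℝ) (f g : HarmonicFock α) :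
    inner ℂ (constShift α c f) g = inner ℂ f (constShift α c g) := by
  simp only [constShift_apply, inner_add_left, inner_add_right, inner_smul_left, inner_smul_right,
    Complex.conj_ofReal, inner_conj_symm]
  ring

theorem norm_constShift_le {c : ℝ} (hc0 : 0 ≤ c) (hc : c ≤ 1) (f : HarmonicFock α) :
    ‖constShift α c f‖ ≤ 2 * ‖f‖ := by
  rw [constShift_apply]
  refine (norm_add_le _ _).trans ?_
  rw [norm_smul, norm_smul, norm_holKernel_zero, mul_one, Complex.norm_real,
    Real.norm_of_nonneg (by linarith)]
  have h := norm_inner_le_norm (𝕜 := ℂ) (holKernel α 0) f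
  rw [norm_holKernel_zero, one_mul] at h
  nlinarith [norm_nonneg (inner ℂ (holKernel α 0) f)]

theorem norm_constShift_sq_le {c : ℝ} (hc0 : 0 ≤ c) (hc : c ≤ 1) (f : HarmonicFock α) :
    ‖constShift α c f‖ ^ 2 ≤ 4 * ‖f‖ ^ 2 := by
  have := pow_le_pow_left₀ (norm_nonneg _) (norm_constShift_le hc0 hc f) 2
  linarith

/-- This identity is the purpose of `constShift`: it converts the reproducing kernel, whose value at
0 is 1, into H_z. -/
theorem constShift_harmKernel_apply (c : ℝ) (z w : ℂ) :
    constShift α c (harmKernel α z) w = kernel c α z w := by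
  rw [constShift_apply, inner_holKernel_zero]
  change harmKernel α z w + ((1 - c : ℝ) : ℂ) * (harmKernel α z 0 * holKernel α 0 w) = _
  rw [harmKernel_apply, harmKernel_apply, holKernel_apply, fockKernel_zero_left,
    fockKernel_zero_right, kernel]
  push_cast
  simp only [map_one]
  ring

/-- The sum of `|⟨k_z, f⟩|² e^{-α|z|²}` over the analytic and the anti-analytic kernel. -/
def splitSq (f : HarmonicFock α) (z : ℂ) : ℝ≥0∞ :=
  weightedSq α (fun z => inner ℂ (holKernel α z) f) z +
    weightedSq α (fun z => inner ℂ (antiKernel α z) f) z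

theorem exists_splitSq_eq (f : HarmonicFock α) :
    ∃ g h : ℂ → ℂ, Differentiable ℂ g ∧ Differentiable ℂ h ∧
      (∀ z, splitSq f z = weightedSq α g z + weightedSq α h z) ∧
      ‖f‖ₑ ^ 2 = ∫⁻ w, ‖g w‖ₑ ^ 2 ∂(gaussian α) + ∫⁻ w, ‖h w‖ₑ ^ 2 ∂(gaussian α) := by
  obtain ⟨g, h, hg, hh, -, h1, h2, h3⟩ := f.exists_entire
  refine ⟨g, h, hg, hh, fun z => ?_, h3⟩
  simp only [splitSq, weightedSq, h1, h2]
  congr 3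
  rw [← ofReal_norm, ← ofReal_norm, RCLike.norm_conj]

theorem measurable_splitSq (f : HarmonicFock α) : Measurable (splitSq f) := by
  obtain ⟨g, h, hg, hh, hs, -⟩ := exists_splitSq_eq f
  rw [funext hs]
  exact (measurable_weightedSq hg.continuous).add (measurable_weightedSq hh.continuous)

theorem ofReal_mul_lintegral_splitSq (f : HarmonicFock α) :
    ENNReal.ofReal (α / Real.pi) * ∫⁻ z, splitSq f z = ‖f‖ₑ ^ 2 := by
  obtain ⟨g, h, hg, hh, hs, hn⟩ := exists_splitSq_eq f
  have hα := alpha_pos (α := α)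
  simp only [hs]
  rw [lintegral_add_left (measurable_weightedSq hg.continuous), mul_add,
    ← lintegral_weightedSq hα hg.continuous, ← lintegral_weightedSq hα hh.continuous, hn]

theorem ofReal_div_pi_inv_mul (x : ℝ≥0∞) :
    ENNReal.ofReal (Real.pi / α) * (ENNReal.ofReal (α / Real.pi) * x) = x := by
  have hα := alpha_pos (α := α)
  have := Real.pi_pos
  rw [← mul_assoc, ← ENNReal.ofReal_mul (by positivity)]
  field_simp
  simp

theorem lintegral_splitSq (f : HarmonicFock α) :
    ∫⁻ z, splitSq f z = ENNReal.ofReal (Real.pi / α) * ‖f‖ₑ ^ 2 := by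
  rw [← ofReal_mul_lintegral_splitSq, ofReal_div_pi_inv_mul]

theorem lintegral_weightedSq_eq (f : HarmonicFock α) :
    ∫⁻ z, weightedSq α f z = ENNReal.ofReal (Real.pi / α) * ‖f‖ₑ ^ 2 := by
  rw [enorm_sq_eq_lintegral, lintegral_weightedSq alpha_pos f.continuous, ofReal_div_pi_inv_mul]

theorem enorm_add_sq_le (x y : ℂ) : ‖x + y‖ₑ ^ 2 ≤ 2 * (‖x‖ₑ ^ 2 + ‖y‖ₑ ^ 2) := by
  rw [enorm_sq_eq, enorm_sq_eq, enorm_sq_eq, ← ENNReal.ofReal_add (by positivity) (by positivity),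
    ← ENNReal.ofReal_ofNat, ← ENNReal.ofReal_mul (by positivity)]
  refine ENNReal.ofReal_le_ofReal ?_
  have := pow_le_pow_left₀ (norm_nonneg _) (norm_add_le x y) 2
  nlinarith [sq_nonneg (‖x‖ - ‖y‖)]

theorem weightedSq_le_splitSq (f : HarmonicFock α) (z : ℂ) :
    weightedSq α f z ≤ 2 * splitSq f z := by
  rw [splitSq, weightedSq, weightedSq, weightedSq, ← add_mul, ← mul_assoc, f.apply_eq z]
  gcongr
  exact enorm_add_sq_le _ _

variable (α) in
-- The submean estimate needs an entire function, so it is applied to the two parts separately; |f|²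
-- itself is controlled only through `splitSq`.
theorem exists_splitSq_le {r : ℝ} (hr : 0 < r) :
    ∃ C : ℝ≥0∞, C ≠ ∞ ∧ ∀ (f : HarmonicFock α) (z : ℂ),
      splitSq f z ≤ C * ∫⁻ w in Metric.ball z r, splitSq f w := by
  obtain ⟨C, hC, hle⟩ := exists_weightedSq_le (α := α) alpha_pos hr
  refine ⟨C, hC, fun f z => ?_⟩
  obtain ⟨g, h, hg, hh, hs, -⟩ := exists_splitSq_eq f
  simp only [hs]
  rw [lintegral_add_left (measurable_weightedSq hg.continuous), mul_add]
  exact add_le_add (hle g hg z) (hle h hh z)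

theorem enorm_constShift_sq_le {c : ℝ} (hc0 : 0 ≤ c) (hc : c ≤ 1) (f : HarmonicFock α) :
    ‖constShift α c f‖ₑ ^ 2 ≤ 4 * ‖f‖ₑ ^ 2 := by
  rw [← ofReal_norm, ← ofReal_norm, ← ENNReal.ofReal_pow (norm_nonneg _),
    ← ENNReal.ofReal_pow (norm_nonneg _), ← ENNReal.ofReal_ofNat,
    ← ENNReal.ofReal_mul (by positivity)]
  exact ENNReal.ofReal_le_ofReal (norm_constShift_sq_le hc0 hc f)

/-- Bessel's inequality for S k_z, after S is moved to the other side. The 16 is 4 · 4: one factor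
from ‖S f‖² ≤ 4‖f‖², one from `hk`. -/
theorem sum_weightedSq_inner_le {c : ℝ} (hc0 : 0 ≤ c) (hc : c ≤ 1) {ι : Type*} (s : Finset ι)
    {e : ι → HarmonicFock α} (he : Orthonormal ℂ e) {k : ℂ → HarmonicFock α} {z : ℂ}
    (hk : ‖k z‖ ^ 2 ≤ 4 * Real.exp (α * ‖z‖ ^ 2)) :
    ∑ i ∈ s, weightedSq α (fun z => inner ℂ (k z) (constShift α c (e i))) z ≤ 16 := by
  have h1 : ∀ i, weightedSq α (fun z => inner ℂ (k z) (constShift α c (e i))) z =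
      ENNReal.ofReal (‖(inner ℂ (e i) (constShift α c (k z)) : ℂ)‖ ^ 2 * weight α z) := fun i => by
    rw [weightedSq, enorm_sq_eq, ← inner_constShift_left, norm_inner_symm,
      ENNReal.ofReal_mul (by positivity)]
  simp only [h1]
  rw [← ENNReal.ofReal_sum_of_nonneg fun i _ => mul_nonneg (sq_nonneg _) (weight_pos _ _).le,
    ← Finset.sum_mul, ← ENNReal.ofReal_ofNat]
  refine ENNReal.ofReal_le_ofReal ?_
  have h2 := he.sum_inner_products_le (constShift α c (k z)) (s := s)
  have h3 := norm_constShift_sq_le hc0 hc (k z)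
  have h4 : Real.exp (α * ‖z‖ ^ 2) * weight α z = 1 := by
    rw [weight, ← Real.exp_add]; simp
  have hw := weight_pos α z
  calc (∑ i ∈ s, ‖(inner ℂ (e i) (constShift α c (k z)) : ℂ)‖ ^ 2) * weight α z
      ≤ (16 * Real.exp (α * ‖z‖ ^ 2)) * weight α z := by gcongr; linarith
    _ = 16 := by rw [mul_assoc, h4, mul_one]

theorem sum_splitSq_le {c : ℝ} (hc0 : 0 ≤ c) (hc : c ≤ 1) {ι : Type*} (s : Finset ι)
    {e : ι → HarmonicFock α} (he : Orthonormal ℂ e) (z : ℂ) :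
    ∑ i ∈ s, splitSq (constShift α c (e i)) z ≤ 32 := by
  have hE := Real.exp_pos (α * ‖z‖ ^ 2)
  have h1 := sum_weightedSq_inner_le hc0 hc s he (k := holKernel α) (z := z)
    (by rw [norm_holKernel_sq]; linarith)
  have h2 := sum_weightedSq_inner_le hc0 hc s he (k := antiKernel α) (z := z)
    ((norm_antiKernel_sq_le z).trans (by linarith))
  simp only [splitSq, Finset.sum_add_distrib]
  refine (add_le_add h1 h2).trans (le_of_eq (by norm_num))

theorem sum_weightedSq_le {c : ℝ} (hc0 : 0 ≤ c) (hc : c ≤ 1) {ι : Type*} (s : Finset ι)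
    {e : ι → HarmonicFock α} (he : Orthonormal ℂ e) (z : ℂ) :
    ∑ i ∈ s, weightedSq α (constShift α c (e i)) z ≤ 16 := by
  have h1 := sum_weightedSq_inner_le hc0 hc s he (norm_harmKernel_sq_le z)
  simpa only [inner_harmKernel] using h1

/-! ### Embeddings into `L²` of a measure -/

/-- The Carleson-type estimate behind the boundedness of the embedding into `L²(e^{-α|w|²} dμ)`. -/
theorem exists_lintegral_weightedSq_le (μ : Measure ℂ) [SFinite μ] {r : ℝ} (hr : 0 < r) :
    ∃ C : ℝ≥0∞, C ≠ ∞ ∧ ∀ f : HarmonicFock α,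
      ∫⁻ z, weightedSq α f z ∂μ ≤ C * ∫⁻ w, splitSq f w * μ (Metric.ball w r) := by
  obtain ⟨C, hC, hle⟩ := exists_splitSq_le α hr
  refine ⟨2 * C, ENNReal.mul_ne_top (by simp) hC, fun f => ?_⟩
  have hm := measurable_splitSq f
  have hset : MeasurableSet {x : ℂ × ℂ | dist x.1 x.2 < r} :=
    (isOpen_lt (by fun_prop) continuous_const).measurableSet
  set Φ : ℂ × ℂ → ℝ≥0∞ := {x : ℂ × ℂ | dist x.1 x.2 < r}.indicator fun x => splitSq f x.2 with hΦ
  have hΦm : Measurable Φ := (hm.comp measurable_snd).indicator hset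
  have h1 : ∀ z, ∫⁻ w in Metric.ball z r, splitSq f w = ∫⁻ w, Φ (z, w) := fun z => by
    rw [← lintegral_indicator measurableSet_ball]
    refine lintegral_congr fun w => ?_
    simp only [hΦ, indicator, Metric.mem_ball, mem_ofPred_eq, dist_comm z]
  have h2 : ∀ w, ∫⁻ z, Φ (z, w) ∂μ = splitSq f w * μ (Metric.ball w r) := fun w => by
    rw [← setLIntegral_const, ← lintegral_indicator measurableSet_ball]
    rfl
  calc ∫⁻ z, weightedSq α f z ∂μ ≤ ∫⁻ z, (2 * C * ∫⁻ w, Φ (z, w)) ∂μ := by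
        refine lintegral_mono fun z => (weightedSq_le_splitSq f z).trans ?_
        rw [mul_assoc, ← h1]
        gcongr
        exact hle f z
    _ = 2 * C * ∫⁻ w, ∫⁻ z, Φ (z, w) ∂μ := by
        rw [lintegral_const_mul _ hΦm.lintegral_prod_right', lintegral_lintegral_swap]
        exact hΦm.aemeasurable
    _ = _ := by simp only [h2]

variable (α) in
/-- The measure `e^{-α|w|²} dμ(w)`. -/
def weightedMeasure (μ : Measure ℂ) : Measure ℂ :=
  μ.withDensity fun w => ENNReal.ofReal (weight α w)

omit [Fact (0 < α)] in
theorem lintegral_weightedMeasure (μ : Measure ℂ) {f : ℂ → ℂ} (hf : Continuous f) :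
    ∫⁻ w, ‖f w‖ₑ ^ 2 ∂(weightedMeasure α μ) = ∫⁻ w, weightedSq α f w ∂μ := by
  rw [weightedMeasure, lintegral_withDensity_eq_lintegral_mul _ (by fun_prop) (by fun_prop)]
  refine lintegral_congr fun w => ?_
  rw [weightedSq, Pi.mul_apply, mul_comm]

theorem memLp_weightedMeasure {μ : Measure ℂ} {C : ℝ≥0∞} (hC : C ≠ ∞)
    (h : ∀ f : HarmonicFock α, ∫⁻ z, weightedSq α f z ∂μ ≤ C * ‖f‖ₑ ^ 2) (f : HarmonicFock α) :
    MemLp f 2 (weightedMeasure α μ) := by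
  refine memLp_two_of_lintegral f.continuous ?_
  rw [lintegral_weightedMeasure μ f.continuous]
  exact ((h f).trans_lt (ENNReal.mul_lt_top hC.lt_top (by simp))).ne

omit [Fact (0 < α)] in
theorem enorm_toLp_sq {μ : Measure ℂ} {f : HarmonicFock α} (hf : MemLp f 2 (weightedMeasure α μ)) :
    ‖hf.toLp‖ₑ ^ 2 = ∫⁻ z, weightedSq α f z ∂μ := by
  rw [Lp.enorm_toLp, eLpNorm_two_sq, lintegral_weightedMeasure μ f.continuous]

theorem exists_embedding {μ : Measure ℂ} {C : ℝ≥0∞} (hC : C ≠ ∞)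
    (h : ∀ f : HarmonicFock α, ∫⁻ z, weightedSq α f z ∂μ ≤ C * ‖f‖ₑ ^ 2) :
    ∃ J : HarmonicFock α →L[ℂ] Lp ℂ 2 (weightedMeasure α μ),
      (∀ f, J f = (memLp_weightedMeasure hC h f).toLp) := by
  have hm := memLp_weightedMeasure hC h
  refine ⟨LinearMap.mkContinuousOfExistsBound
    { toFun := fun f => (hm f).toLp
      map_add' := fun f g => MemLp.toLp_add (hm f) (hm g)
      map_smul' := fun a f => MemLp.toLp_const_smul a (hm f) } ⟨Real.sqrt C.toReal, fun f => ?_⟩,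
    fun f => rfl⟩
  change ‖(hm f).toLp‖ ≤ _
  refine le_of_sq_le_sq ?_ (by positivity)
  rw [mul_pow, Real.sq_sqrt ENNReal.toReal_nonneg]
  have h2 := h f
  rw [← enorm_toLp_sq (hm f)] at h2
  have h3 := ENNReal.toReal_mono (ENNReal.mul_ne_top hC (by simp)) h2
  simpa using h3

omit [Fact (0 < α)] in
theorem integrable_weightedMeasure_iff {μ : Measure ℂ} (f : ℂ → ℂ) :
    Integrable f (weightedMeasure α μ) ↔ Integrable (fun w => f w * (weight α w : ℂ)) μ := by
  rw [weightedMeasure, integrable_withDensity_iff_integrable_smul' (by fun_prop) (by simp)]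
  refine integrable_congr (Filter.Eventually.of_forall fun w => ?_)
  simp only [ENNReal.toReal_ofReal (weight_pos α w).le, Complex.real_smul, mul_comm]

omit [Fact (0 < α)] in
theorem integral_weightedMeasure {μ : Measure ℂ} (f : ℂ → ℂ) :
    ∫ w, f w ∂(weightedMeasure α μ) = ∫ w, f w * (weight α w : ℂ) ∂μ := by
  rw [weightedMeasure, integral_withDensity_eq_integral_toReal_smul (by fun_prop) (by simp)]
  refine integral_congr_ae (Filter.Eventually.of_forall fun w => ?_)
  simp only [ENNReal.toReal_ofReal (weight_pos α w).le, Complex.real_smul, mul_comm]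

/-- Take T = S J* J with J the embedding into L² of the weighted measure. Then ⟨f, T e⟩ = ⟨J S f, J
e⟩, and f = R_z gives the integral formula because S R_z = H_z. -/
theorem exists_isToeplitz (c : ℝ) {μ : Measure ℂ} {C : ℝ≥0∞} (hC : C ≠ ∞)
    (h : ∀ f : HarmonicFock α, ∫⁻ z, weightedSq α f z ∂μ ≤ C * ‖f‖ₑ ^ 2) :
    ∃ T : HarmonicFock α →L[ℂ] HarmonicFock α, IsToeplitz c α μ T ∧
      ∀ e f, ‖(inner ℂ f (T e) : ℂ)‖ₑ ≤
        ∫⁻ z, weightedSq α (constShift α c f) z ∂μ + ∫⁻ z, weightedSq α e z ∂μ := by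
  obtain ⟨J, hJ⟩ := exists_embedding hC h
  have hm := memLp_weightedMeasure hC h
  set T := constShift α c ∘L ContinuousLinearMap.adjoint J ∘L J with hT
  have hinner : ∀ e f, inner ℂ f (T e) = inner ℂ (J (constShift α c f)) (J e) := fun e f => by
    rw [hT, ContinuousLinearMap.comp_apply, ContinuousLinearMap.comp_apply,
      ← inner_constShift_left, ContinuousLinearMap.adjoint_inner_right]
  refine ⟨T, fun f z => ?_, fun e f => ?_⟩
  · have hprod : Integrable (fun w => f w * conj (kernel c α z w)) (weightedMeasure α μ) := by
      have := integrable_mul_of_memLp (hm f) (memLp_conj (hm (constShift α c (harmKernel α z))))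
      simpa only [constShift_harmKernel_apply] using this
    refine ⟨(integrable_weightedMeasure_iff _).1 hprod, ?_⟩
    refine Eq.trans ?_ (integral_weightedMeasure _)
    rw [← inner_harmKernel (T f) z, hinner, L2.inner_def]
    refine integral_congr_ae ?_
    rw [hJ, hJ]
    filter_upwards [(hm f).coeFn_toLp, (hm (constShift α c (harmKernel α z))).coeFn_toLp]
      with w h1 h2
    rw [h1, h2, RCLike.inner_apply, constShift_harmKernel_apply]
  · rw [hinner, ← enorm_toLp_sq (hm (constShift α c f)), ← enorm_toLp_sq (hm e), ← hJ, ← hJ]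
    have h1 := norm_inner_le_norm (𝕜 := ℂ) (J (constShift α c f)) (J e)
    have h2 : ‖(inner ℂ (J (constShift α c f)) (J e) : ℂ)‖ ≤
        ‖J (constShift α c f)‖ ^ 2 + ‖J e‖ ^ 2 := by
      nlinarith [sq_nonneg (‖J (constShift α c f)‖ - ‖J e‖), sq_nonneg ‖J (constShift α c f)‖,
        sq_nonneg ‖J e‖]
    rw [← ofReal_norm, ← ofReal_norm, ← ofReal_norm, ← ENNReal.ofReal_pow (norm_nonneg _),
      ← ENNReal.ofReal_pow (norm_nonneg _), ← ENNReal.ofReal_add (by positivity) (by positivity)]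
    exact ENNReal.ofReal_le_ofReal h2

/-- For each i, Jensen's inequality is applied to the measure with density `splitSq` of S e_i, whose
total mass is at most D = 4π/α. Summing over i under the integral then uses the Bessel bound 32. -/
theorem exists_sum_rpow_le {c : ℝ} (hc0 : 0 ≤ c) (hc : c ≤ 1) {μ : Measure ℂ} [SFinite μ]
    {r : ℝ} (hr : 0 < r) {q : ℝ} (hq : 1 ≤ q)
    (hμ : ∫⁻ z, μ (Metric.ball z r) ^ q < ∞) :
    ∃ B : ℝ≥0∞, B ≠ ∞ ∧ ∀ (ι : Type) [Fintype ι] (e : ι → HarmonicFock α), Orthonormal ℂ e →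
      ∑ i, (∫⁻ z, weightedSq α (constShift α c (e i)) z ∂μ) ^ q ≤ B := by
  obtain ⟨C, hC, hle⟩ := exists_lintegral_weightedSq_le (α := α) μ hr
  have hq0 : 0 ≤ q := by linarith
  set D := ENNReal.ofReal (Real.pi / α) * 4 with hD
  have hDt : D ≠ ∞ := ENNReal.mul_ne_top (by simp) (by simp)
  refine ⟨C ^ q * D ^ (q - 1) * (32 * ∫⁻ z, μ (Metric.ball z r) ^ q),
    ENNReal.mul_ne_top (ENNReal.mul_ne_top (ENNReal.rpow_ne_top_of_nonneg hq0 hC)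
      (ENNReal.rpow_ne_top_of_nonneg (by linarith) hDt)) (ENNReal.mul_ne_top (by simp) hμ.ne),
    fun ι _ e he => ?_⟩
  have hmb := measurable_measure_ball μ r
  have hterm : ∀ i, (∫⁻ z, weightedSq α (constShift α c (e i)) z ∂μ) ^ q ≤
      C ^ q * D ^ (q - 1) *
        ∫⁻ w, splitSq (constShift α c (e i)) w * μ (Metric.ball w r) ^ q := fun i => by
    have hsm := measurable_splitSq (constShift α c (e i))
    have hJ := lintegral_rpow_le (volume.withDensity (splitSq (constShift α c (e i))))
      (hmb.aemeasurable) hq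
    rw [lintegral_withDensity_eq_lintegral_mul _ hsm hmb,
      lintegral_withDensity_eq_lintegral_mul _ hsm (hmb.pow_const q),
      withDensity_apply _ MeasurableSet.univ, setLIntegral_univ, lintegral_splitSq] at hJ
    simp only [Pi.mul_apply] at hJ
    have hn : ENNReal.ofReal (Real.pi / α) * ‖constShift α c (e i)‖ₑ ^ 2 ≤ D := by
      rw [hD]
      gcongr
      refine (enorm_constShift_sq_le hc0 hc (e i)).trans ?_
      rw [← ofReal_norm, he.1 i]
      simp
    calc (∫⁻ z, weightedSq α (constShift α c (e i)) z ∂μ) ^ q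
        ≤ (C * ∫⁻ w, splitSq (constShift α c (e i)) w * μ (Metric.ball w r)) ^ q :=
          ENNReal.rpow_le_rpow (hle _) hq0
      _ = C ^ q * (∫⁻ w, splitSq (constShift α c (e i)) w * μ (Metric.ball w r)) ^ q :=
          ENNReal.mul_rpow_of_nonneg _ _ hq0
      _ ≤ C ^ q * (D ^ (q - 1) *
          ∫⁻ w, splitSq (constShift α c (e i)) w * μ (Metric.ball w r) ^ q) := by
          gcongr
          refine hJ.trans ?_
          gcongr
      _ = _ := by ring
  calc ∑ i, (∫⁻ z, weightedSq α (constShift α c (e i)) z ∂μ) ^ q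
      ≤ ∑ i, C ^ q * D ^ (q - 1) *
        ∫⁻ w, splitSq (constShift α c (e i)) w * μ (Metric.ball w r) ^ q :=
        Finset.sum_le_sum fun i _ => hterm i
    _ = C ^ q * D ^ (q - 1) *
        ∫⁻ w, (∑ i, splitSq (constShift α c (e i)) w) * μ (Metric.ball w r) ^ q := by
        rw [← Finset.mul_sum, ← lintegral_finsetSum]
        · simp only [Finset.sum_mul]
        · exact fun i _ => (measurable_splitSq _).mul (hmb.pow_const q)
    _ ≤ C ^ q * D ^ (q - 1) * (32 * ∫⁻ w, μ (Metric.ball w r) ^ q) := by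
        rw [← lintegral_const_mul _ (hmb.pow_const q)]
        gcongr with w
        exact sum_splitSq_le hc0 hc _ he w

theorem toeplitzInSchatten_of_eLpNorm {c : ℝ} (hc0 : 0 ≤ c) (hc : c ≤ 1) {μ : Measure ℂ}
    [IsLocallyFiniteMeasure μ] {p : ℝ≥0∞} (hp : 1 ≤ p) {r : ℝ} (hr : 0 < r)
    (h : eLpNorm (fun z => μ (Metric.ball z r)) p volume < ∞) :
    ToeplitzInSchatten c α μ p := by
  obtain ⟨M, hM, hMle⟩ := exists_measure_ball_le hp hr h
  obtain ⟨C, hC, hle⟩ := exists_lintegral_weightedSq_le (α := α) μ hr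
  have hbound : ∀ f : HarmonicFock α, ∫⁻ z, weightedSq α f z ∂μ ≤
      C * (M * ENNReal.ofReal (Real.pi / α)) * ‖f‖ₑ ^ 2 := fun f => by
    refine (hle f).trans ?_
    rw [mul_assoc, mul_assoc, ← lintegral_splitSq, mul_comm M,
      ← lintegral_mul_const _ (measurable_splitSq f)]
    gcongr with w
    exact hMle w
  obtain ⟨T, hT, hTle⟩ := exists_isToeplitz c
    (ENNReal.mul_ne_top hC (ENNReal.mul_ne_top hM (by simp))) hbound
  refine ⟨T, hT, ?_⟩
  by_cases hpt : p = ∞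
  · exact Or.inl hpt
  have hp0 : p ≠ 0 := (zero_lt_one.trans_le hp).ne'
  have hq : 1 ≤ p.toReal := by simpa using ENNReal.toReal_mono hpt hp
  rw [eLpNorm_lt_top_iff_lintegral_rpow_enorm_lt_top hp0 hpt] at h
  simp only [enorm_eq_self] at h
  obtain ⟨B₁, hB₁, hle₁⟩ := exists_sum_rpow_le (α := α) hc0 hc hr hq h
  -- For c = 1 the shift is the identity, which gives the bound for the unshifted vectors e_i.
  obtain ⟨B₂, hB₂, hle₂⟩ := exists_sum_rpow_le (α := α) zero_le_one le_rfl hr hq h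
  simp only [constShift_one, ContinuousLinearMap.id_apply] at hle₂
  set q := p.toReal with hqdef
  have hBt : 2 ^ (q - 1) * (B₁ + B₂) ≠ ∞ :=
    ENNReal.mul_ne_top (ENNReal.rpow_ne_top_of_nonneg (by linarith) (by simp))
      (ENNReal.add_ne_top.2 ⟨hB₁, hB₂⟩)
  refine isSchatten_of_sum_le hp0 hpt (M := (2 ^ (q - 1) * (B₁ + B₂)).toReal)
    fun ι _ e f he hf => ?_
  rw [← ENNReal.ofReal_le_iff_le_toReal hBt, ENNReal.ofReal_sum_of_nonneg
    fun i _ => Real.rpow_nonneg (norm_nonneg _) _]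
  calc ∑ i, ENNReal.ofReal (‖(inner ℂ (f i) (T (e i)) : ℂ)‖ ^ q)
      = ∑ i, ‖(inner ℂ (f i) (T (e i)) : ℂ)‖ₑ ^ q := by
        refine Finset.sum_congr rfl fun i _ => ?_
        rw [← ENNReal.ofReal_rpow_of_nonneg (norm_nonneg _) (by linarith), ofReal_norm]
    _ ≤ ∑ i, 2 ^ (q - 1) * ((∫⁻ z, weightedSq α (constShift α c (f i)) z ∂μ) ^ q +
          (∫⁻ z, weightedSq α (e i) z ∂μ) ^ q) := by
        refine Finset.sum_le_sum fun i _ => ?_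
        exact (ENNReal.rpow_le_rpow (hTle (e i) (f i)) (by linarith)).trans
          (ENNReal.rpow_add_le_mul_rpow_add_rpow _ _ hq)
    _ ≤ 2 ^ (q - 1) * (B₁ + B₂) := by
        rw [← Finset.mul_sum, Finset.sum_add_distrib]
        gcongr
        · exact hle₁ ι f hf
        · exact hle₂ ι e he

end Toeplitz

/-! ### The Berezin transform of a Toeplitz operator -/

section Converse

variable {α : ℝ} [Fact (0 < α)] {c : ℝ} {μ : Measure ℂ}

/-- Evaluating T H_z at z gives ∫ |H_z|² e^{-α|w|²} dμ, and 1/H_z(z) ≤ e^{-α|z|²}. The integrability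
contained in `IsToeplitz` replaces any finiteness assumption on μ. -/
theorem berezin_le_of_isToeplitz (hc : c ≤ 1) {T : HarmonicFock α →L[ℂ] HarmonicFock α}
    (hT : IsToeplitz c α μ T) (z : ℂ) :
    berezin c α μ z ≤
      ‖(inner ℂ (harmKernel α z) (T (constShift α c (harmKernel α z))) : ℂ)‖ₑ *
        ENNReal.ofReal (weight α z) := by
  have hα := alpha_pos (α := α)
  set D := (kernel c α z z).re with hD
  have hE := Real.exp_pos (α * ‖z‖ ^ 2)
  have hDE := exp_le_kernel_self hα hc z
  obtain ⟨hi, he⟩ := hT (constShift α c (harmKernel α z)) z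
  simp only [constShift_harmKernel_apply] at hi he
  have hpt : ∀ w, kernel c α z w * conj (kernel c α z w) * (Real.exp (-α * ‖w‖ ^ 2) : ℂ) =
      ((‖kernel c α z w‖ ^ 2 * weight α w : ℝ) : ℂ) := fun w => by
    rw [Complex.mul_conj, Complex.normSq_eq_norm_sq, weight]
    push_cast
    rfl
  simp only [hpt] at hi he
  rw [integral_complex_ofReal] at he
  have hi' : Integrable (fun w => ‖kernel c α z w‖ ^ 2 * weight α w) μ := hi.re
  have hnn : 0 ≤ᵐ[μ] fun w => ‖kernel c α z w‖ ^ 2 * weight α w :=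
    Filter.Eventually.of_forall fun w => mul_nonneg (sq_nonneg _) (weight_pos _ _).le
  have h1 : ∀ w, berezinKernel c α z w ≤
      ENNReal.ofReal (‖kernel c α z w‖ ^ 2 * weight α w) * ENNReal.ofReal (weight α z) := fun w => by
    rw [berezinKernel, norm_normKernel_sq hα hc,
      ← ENNReal.ofReal_mul (mul_nonneg (sq_nonneg _) (weight_pos _ _).le)]
    refine ENNReal.ofReal_le_ofReal ?_
    have h2 : (kernel c α z z).re⁻¹ ≤ weight α z := by
      rw [weight, neg_mul, Real.exp_neg]
      exact inv_anti₀ hE hDE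
    have hw := weight_pos α w
    rw [div_eq_mul_inv, mul_right_comm]
    gcongr
  rw [inner_harmKernel, he, berezin_eq]
  calc ∫⁻ w, berezinKernel c α z w ∂μ
      ≤ ∫⁻ w, ENNReal.ofReal (‖kernel c α z w‖ ^ 2 * weight α w) *
          ENNReal.ofReal (weight α z) ∂μ := lintegral_mono h1
    _ = ENNReal.ofReal (∫ w, ‖kernel c α z w‖ ^ 2 * weight α w ∂μ) *
          ENNReal.ofReal (weight α z) := by
        rw [lintegral_mul_const' _ _ ENNReal.ofReal_ne_top,
          ofReal_integral_eq_lintegral_ofReal hi' hnn]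
    _ ≤ _ := by
        gcongr
        rw [← ofReal_norm, Complex.norm_real]
        exact ENNReal.ofReal_le_ofReal (le_abs_self _)

theorem berezin_le_const_of_isToeplitz (hc0 : 0 ≤ c) (hc : c ≤ 1)
    {T : HarmonicFock α →L[ℂ] HarmonicFock α} (hT : IsToeplitz c α μ T) (z : ℂ) :
    berezin c α μ z ≤ ENNReal.ofReal (8 * ‖T‖) := by
  refine (berezin_le_of_isToeplitz hc hT z).trans ?_
  rw [← ofReal_norm, ← ENNReal.ofReal_mul (norm_nonneg _)]
  refine ENNReal.ofReal_le_ofReal ?_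
  have hw := weight_pos α z
  have h4 : Real.exp (α * ‖z‖ ^ 2) * weight α z = 1 := by
    rw [weight, ← Real.exp_add]; simp
  calc ‖(inner ℂ (harmKernel α z) (T (constShift α c (harmKernel α z))) : ℂ)‖ * weight α z
      ≤ (‖harmKernel α z‖ * (‖T‖ * (2 * ‖harmKernel α z‖))) * weight α z := by
        gcongr
        refine (norm_inner_le_norm _ _).trans ?_
        gcongr
        refine (T.le_opNorm _).trans ?_
        gcongr
        exact norm_constShift_le hc0 hc _
    _ = 2 * ‖T‖ * ‖harmKernel α z‖ ^ 2 * weight α z := by ring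
    _ ≤ 2 * ‖T‖ * (4 * Real.exp (α * ‖z‖ ^ 2)) * weight α z := by
        gcongr
        exact norm_harmKernel_sq_le z
    _ = 8 * ‖T‖ := by linear_combination (8 * ‖T‖) * h4

/-- Jensen's inequality for counting measure with density w. -/
theorem tsum_mul_rpow_le {ι : Type*} (w s : ι → ℝ≥0∞) {q : ℝ} (hq : 1 ≤ q) :
    (∑' i, w i * s i) ^ q ≤ (∑' i, w i) ^ (q - 1) * ∑' i, w i * s i ^ q := by
  let _ : MeasurableSpace ι := ⊤
  have hmeas : ∀ f : ι → ℝ≥0∞, Measurable f := fun f => measurable_from_top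
  have h := lintegral_rpow_le (Measure.count.withDensity w) (hmeas s).aemeasurable hq
  rwa [lintegral_withDensity_eq_lintegral_mul _ (hmeas w) (hmeas s),
    lintegral_withDensity_eq_lintegral_mul _ (hmeas w) (hmeas _),
    withDensity_apply _ MeasurableSet.univ, setLIntegral_univ, lintegral_count, lintegral_count,
    lintegral_count] at h

theorem mul_le_sq_add_sq (x y : ℝ≥0∞) : x * y ≤ x ^ 2 + y ^ 2 := by
  rcases le_total x y with h | h
  · calc x * y ≤ y * y := by gcongr
      _ = y ^ 2 := (sq y).symm
      _ ≤ _ := le_add_self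
  · calc x * y ≤ x * x := by gcongr
      _ = x ^ 2 := (sq x).symm
      _ ≤ _ := le_self_add

/-- The i-th term of ⟨R_z, T S R_z⟩ is s_i conj((S e_i)(z)) f_i(z); the product is split by xy ≤ x²
+ y². -/
theorem berezin_le_tsum (hc : c ≤ 1)
    {T : HarmonicFock α →L[ℂ] HarmonicFock α} (hT : IsToeplitz c α μ T) {ι : Type}
    {e f : ι → HarmonicFock α} {s : ι → ℝ}
    (hsum : ∀ x, HasSum (fun i => ((s i : ℂ) * inner ℂ (e i) x) • f i) (T x)) (z : ℂ) :
    berezin c α μ z ≤ ∑' i, (weightedSq α (constShift α c (e i)) z + weightedSq α (f i) z) *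
      ‖s i‖ₑ := by
  refine (berezin_le_of_isToeplitz hc hT z).trans ?_
  have h1 := (hsum (constShift α c (harmKernel α z))).mapL (innerSL ℂ (harmKernel α z))
  rw [innerSL_apply_apply] at h1
  rw [← h1.tsum_eq]
  refine (mul_le_mul_left enorm_tsum_le_tsum_enorm _).trans ?_
  rw [← ENNReal.tsum_mul_right]
  refine ENNReal.tsum_le_tsum fun i => ?_
  have h2 : innerSL ℂ (harmKernel α z)
      (((s i : ℂ) * inner ℂ (e i) (constShift α c (harmKernel α z))) • f i) =
      (s i : ℂ) * (conj (constShift α c (e i) z) * f i z) := by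
    rw [map_smul, innerSL_apply_apply, inner_harmKernel, ← inner_constShift_left,
      ← inner_conj_symm, inner_harmKernel, smul_eq_mul, mul_assoc]
  have h3 : ‖(s i : ℂ)‖ₑ = ‖s i‖ₑ := by
    rw [← ofReal_norm, Complex.norm_real, ofReal_norm]
  have h4 : ‖conj (constShift α c (e i) z)‖ₑ = ‖constShift α c (e i) z‖ₑ := by
    rw [← ofReal_norm, RCLike.norm_conj, ofReal_norm]
  rw [h2, enorm_mul, enorm_mul, h3, h4, weightedSq, weightedSq, ← add_mul]
  calc ‖s i‖ₑ * (‖constShift α c (e i) z‖ₑ * ‖f i z‖ₑ) * ENNReal.ofReal (weight α z)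
      ≤ ‖s i‖ₑ * (‖constShift α c (e i) z‖ₑ ^ 2 + ‖f i z‖ₑ ^ 2) * ENNReal.ofReal (weight α z) := by
        gcongr
        exact mul_le_sq_add_sq _ _
    _ = _ := by ring

/-- The weights w_i(z) sum to at most 32 over i (Bessel) and integrate to at most 5π/α over z. The
first bound feeds Jensen's inequality, the second leaves a multiple of ∑ s_i^q after Tonelli. -/
theorem lintegral_berezin_rpow_lt_top (hc0 : 0 ≤ c) (hc : c ≤ 1)
    {T : HarmonicFock α →L[ℂ] HarmonicFock α} (hT : IsToeplitz c α μ T) {ι : Type} [Countable ι]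
    {e f : ι → HarmonicFock α} {s : ι → ℝ} (he : Orthonormal ℂ e) (hf : Orthonormal ℂ f)
    (hsum : ∀ x, HasSum (fun i => ((s i : ℂ) * inner ℂ (e i) x) • f i) (T x))
    {q : ℝ} (hq : 1 ≤ q) (hs : Summable fun i => ‖s i‖ ^ q) :
    ∫⁻ z, berezin c α μ z ^ q < ∞ := by
  set w : ι → ℂ → ℝ≥0∞ := fun i z =>
    weightedSq α (constShift α c (e i)) z + weightedSq α (f i) z with hw
  have hm1 : ∀ i, Measurable (weightedSq α (constShift α c (e i))) := fun i =>
    measurable_weightedSq (constShift α c (e i)).continuous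
  have hm2 : ∀ i, Measurable (weightedSq α (f i)) := fun i =>
    measurable_weightedSq (f i).continuous
  have hwm : ∀ i, Measurable (w i) := fun i => (hm1 i).add (hm2 i)
  have hwsum : ∀ z, ∑' i, w i z ≤ 32 := fun z => by
    rw [ENNReal.tsum_eq_iSup_sum]
    refine iSup_le fun S => ?_
    have h1 := sum_weightedSq_le hc0 hc S he z
    have h2 := sum_weightedSq_le zero_le_one le_rfl S hf z
    simp only [constShift_one, ContinuousLinearMap.id_apply] at h2
    simp only [hw, Finset.sum_add_distrib]
    exact (add_le_add h1 h2).trans (le_of_eq (by norm_num))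
  have hwint : ∀ i, ∫⁻ z, w i z ≤ ENNReal.ofReal (Real.pi / α) * 5 := fun i => by
    simp only [hw]
    rw [lintegral_add_left (hm1 i), lintegral_weightedSq_eq, lintegral_weightedSq_eq, ← mul_add]
    gcongr
    have h1 := enorm_constShift_sq_le hc0 hc (e i)
    rw [← ofReal_norm (e i), he.1 i] at h1
    rw [← ofReal_norm (f i), hf.1 i]
    refine (add_le_add_left h1 _).trans (le_of_eq ?_)
    norm_num
  have hst : ∑' i, ‖s i‖ₑ ^ q ≠ ∞ := by
    have h1 := hs.tsum_ofReal_ne_top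
    convert h1 using 4 with i
    rw [← ENNReal.ofReal_rpow_of_nonneg (norm_nonneg _) (by linarith), ofReal_norm]
  calc ∫⁻ z, berezin c α μ z ^ q
      ≤ ∫⁻ z, 32 ^ (q - 1) * ∑' i, w i z * ‖s i‖ₑ ^ q := by
        refine lintegral_mono fun z => ?_
        refine (ENNReal.rpow_le_rpow (berezin_le_tsum hc hT hsum z) (by linarith)).trans ?_
        refine (tsum_mul_rpow_le _ _ hq).trans ?_
        gcongr
        exact hwsum z
    _ = 32 ^ (q - 1) * ∑' i, (∫⁻ z, w i z) * ‖s i‖ₑ ^ q := by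
        rw [lintegral_const_mul _ (Measurable.tsum fun i => (hwm i).mul_const _),
          lintegral_tsum fun i => ((hwm i).mul_const _).aemeasurable]
        simp only [lintegral_mul_const _ (hwm _)]
    _ ≤ 32 ^ (q - 1) * ∑' i, (ENNReal.ofReal (Real.pi / α) * 5) * ‖s i‖ₑ ^ q := by
        gcongr with i
        exact hwint i
    _ < ∞ := by
        rw [ENNReal.tsum_mul_left]
        exact ENNReal.mul_lt_top (ENNReal.rpow_lt_top_of_nonneg (by linarith) (by simp))
          (ENNReal.mul_lt_top (ENNReal.mul_lt_top (by simp) (by simp)) hst.lt_top)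

theorem eLpNorm_berezin_of_toeplitzInSchatten (hc0 : 0 ≤ c) (hc : c ≤ 1) {p : ℝ≥0∞} (hp : 1 ≤ p)
    (h : ToeplitzInSchatten c α μ p) : eLpNorm (berezin c α μ) p volume < ∞ := by
  obtain ⟨T, hT, hS⟩ := h
  by_cases hpt : p = ∞
  · subst hpt
    rw [eLpNorm_exponent_top]
    exact (essSup_le_of_ae_le _ (Filter.Eventually.of_forall fun z =>
      berezin_le_const_of_isToeplitz hc0 hc hT z)).trans_lt ENNReal.ofReal_lt_top
  have hp0 : p ≠ 0 := (zero_lt_one.trans_le hp).ne'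
  have hq : 1 ≤ p.toReal := by simpa using ENNReal.toReal_mono hpt hp
  have hq0 : 0 < p.toReal := by linarith
  obtain ⟨ι, e, f, s, he, hf, -, hs, hsum⟩ := hS.resolve_left hpt
  have hsm := hs.summable hq0
  -- The index type is arbitrary, but a summable family has countable support; restricting to it
  -- allows the exchange of sum and integral.
  have hcount : Countable {i // s i ≠ 0} := by
    have h1 := hsm.countable_support
    refine (h1.mono fun i hi => ?_).to_subtype
    exact (Real.rpow_pos_of_pos (norm_pos_iff.2 hi) _).ne'
  rw [eLpNorm_lt_top_iff_lintegral_rpow_enorm_lt_top hp0 hpt]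
  simp only [enorm_eq_self]
  refine lintegral_berezin_rpow_lt_top hc0 hc hT (ι := {i // s i ≠ 0}) (e := fun i => e i)
    (f := fun i => f i) (s := fun i => s i) (he.comp _ Subtype.val_injective)
    (hf.comp _ Subtype.val_injective) (fun x => ?_) hq (hsm.subtype _)
  have hsupp : Function.support (fun i => ((s i : ℂ) * inner ℂ (e i) x) • f i) ⊆
      {i | s i ≠ 0} := by
    intro i hi h0
    exact hi (by simp [h0])
  exact (hasSum_subtype_iff_of_support_subset hsupp).2 (hsum x)

end Converse

end HFock

end

/-! ### The cycle of implications -/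

theorem theorem4p2 (α : ℝ) [Fact (0 < α)] (c : ℝ) (hc : c = 0 ∨ c = 1)
    (μ : MeasureTheory.Measure ℂ) (p : ℝ≥0∞) (hp : 1 ≤ p) (r : ℝ) (hr : 0 < r)
    (a : ℕ → ℂ) (ha_inj : Function.Injective a) (ha_range : Set.range a = HFock.lattice r) :
    List.TFAE
      [HFock.ToeplitzInSchatten c α μ p,
        MeasureTheory.MemLp (HFock.berezin c α μ) p MeasureTheory.volume,
        MeasureTheory.MemLp (HFock.average μ r) p MeasureTheory.volume,
        (∀ n, μ (Metric.ball (a n) r) < ∞) ∧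
          Memℓp (fun n => (μ (Metric.ball (a n) r)).toReal) p] := by
  have hα : 0 < α := Fact.out
  have hc0 : 0 ≤ c := by rcases hc with rfl | rfl <;> norm_num
  have hc1 : c ≤ 1 := by rcases hc with rfl | rfl <;> norm_num
  tfae_have 1 → 2 := fun h =>
    ⟨(HFock.measurable_berezin hα hc1 μ).aestronglyMeasurable,
      HFock.eLpNorm_berezin_of_toeplitzInSchatten hc0 hc1 hp h⟩
  tfae_have 2 → 3 := fun h => by
    -- Nothing is assumed about μ, so local finiteness must be secured before Tonelli can be used.
    have := HFock.isLocallyFiniteMeasure_of_berezin hα hc1 hp h.2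
    exact ⟨((HFock.measurable_measure_ball μ r).div_const _).aestronglyMeasurable,
      (HFock.eLpNorm_average_lt_top_iff hp hr).2
        (HFock.eLpNorm_measure_ball_of_berezin hα hc0 hc1 hp hr h.2)⟩
  tfae_have 3 → 4 := fun h => by
    have h2 := (HFock.eLpNorm_average_lt_top_iff hp hr).1 h.2
    have := HFock.isLocallyFiniteMeasure_of_average hp hr h2
    exact ⟨fun n => measure_ball_lt_top,
      HFock.memℓp_lattice_of_eLpNorm hp hr ha_inj ha_range h2⟩
  tfae_have 4 → 1 := fun h => by
    have := HFock.isLocallyFiniteMeasure_of_lattice hr ha_range h.1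
    -- The lattice condition controls averages of radius r/4, and any positive radius suffices here.
    exact HFock.toeplitzInSchatten_of_eLpNorm hc0 hc1 hp (by positivity)
      (HFock.eLpNorm_measure_ball_of_lattice hp hr ha_range h.1 h.2)
  tfae_finish
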